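/- Let $k$ be a commutative ring. Let $\mathrm{Sp}_k(\mathrm{gpd})$ be the $k$-linear category of spans of finite groupoids. Its objects are the finite groupoids. Equivalence classes of spans $X\leftarrow S\to Y$ of finite groupoids (two spans being equivalent if there is an equivalence $S\simeq S'$ compatible with the legs up to natural isomorphism) form a commutative monoid under disjoint union of middle objects, and the module of morphisms $X\to Y$ is $k\otimes_{\mathbb Z}$ of the group completion of this monoid. Composition is induced $k$-bilinearly by the iso-comma construction. Finite groups are regarded as one-object groupoids. For a finite group $G$, a subgroup $i\colon H\hookrightarrow G$, a quotient map $p\colon G\to G/N$ and a group isomorphism $f\colon G\to G'$, the *elementary spans* are $$\mathrm{Res}^G_H=[G\xleftarrow{i}H=H],\quad \mathrm{Ind}^G_H=[H=H\xrightarrow{i}G],\quad \mathrm{Infl}^G_{G/N}=[G/N\xleftarrow{p}G=G],\quad \mathrm{Defl}^G_{G/N}=[G=G\xrightarrow{p}G/N],\quad \mathrm{Iso}(f)=[G=G\xrightarrow{f}G'].$$ **Theorem.** $\mathrm{Sp}_k(\mathrm{gpd})$ is an additive $k$-linear category, and as such it is generated by the elementary spans: every object is isomorphic to a finite direct sum of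 finite groups, and every morphism between finite direct sums of finite groups is a matrix of maps each of which is a $k$-linear combination of composites of elementary spans. Moreover the ideal of all relations is generated by the relations below. That is: these relations hold in $\mathrm{Sp}_k(\mathrm{gpd})$; two matrices of formal $k$-linear combinations of composable strings of elementary spans represent the same morphism if and only if, entry by entry, they are congruent modulo the $k$-linear categorical ideal generated by the relations; and the induced functor to $\mathrm{Sp}_k(\mathrm{gpd})$ from the additive hull of the $k$-linear category presented by the elementary spans and these relations is an equivalence. Here the canonical isomorphisms between groups such as $G/1\cong G$, $(G/N)/(M/N)\cong G/M$ or $(G/M)/(MN/M)\cong G/MN$ are suppressed from the notation, and ${}^xK=xKx^{-1}$, $H^x=x^{-1}Hx$. 0. Triviality. (a) $\mathrm{Res}^G_G=\mathrm{Ind}^G_G=\mathrm{Defl}^G_{G/1}=\mathrm{Infl}^G_{G/1}=\mathrm{id}_G$. (b) $\mathrm{Iso}(f)=\mathrm{id}_G$ for every inner automorphism $f$ of $G$. 1. Transitivity. (a) $\mathrm{Res}^H_K\mathrm{Res}^G_H=\mathrm{Res}^G_K$ and $\mathrm{Ind}^G_H\mathrm{Ind}^H_K=\mathrm{Ind}^G_K$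 for $K\le H\le G$. (b) $\mathrm{Iso}(f')\mathrm{Iso}(f)=\mathrm{Iso}(f'f)$ for composable isomorphisms. (c) $\mathrm{Infl}^G_{G/N}\mathrm{Infl}^{G/N}_{G/M}=\mathrm{Infl}^G_{G/M}$ and $\mathrm{Defl}^{G/N}_{G/M}\mathrm{Defl}^G_{G/N}=\mathrm{Defl}^G_{G/M}$ for normal subgroups $N\le M$ of $G$. 2. Commutativity. (a) For $K\le G$ and an isomorphism $f\colon G\to G'$ inducing $\tilde f\colon K\to f(K)$: $\mathrm{Iso}(\tilde f)\mathrm{Res}^G_K=\mathrm{Res}^{G'}_{f(K)}\mathrm{Iso}(f)$ and $\mathrm{Iso}(f)\mathrm{Ind}^G_K=\mathrm{Ind}^{G'}_{f(K)}\mathrm{Iso}(\tilde f)$. (b) For $N\trianglelefteq G$ and an isomorphism $f\colon G\to G'$ inducing $\bar f\colon G/N\to G'/f(N)$: $\mathrm{Iso}(\bar f)\mathrm{Defl}^G_{G/N}=\mathrm{Defl}^{G'}_{G'/f(N)}\mathrm{Iso}(f)$ and $\mathrm{Iso}(f)\mathrm{Infl}^G_{G/N}=\mathrm{Infl}^{G'}_{G'/f(N)}\mathrm{Iso}(\bar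 f)$. (c) (Mackey formula) For $H,K\le G$ and any set $[H\backslash G/K]$ of representatives of the double cosets, with $c_x\colon H^x\cap K\to H\cap{}^xK$, $g\mapsto xgx^{-1}$: $\mathrm{Res}^G_H\mathrm{Ind}^G_K=\sum_{x\in[H\backslash G/K]}\mathrm{Ind}^H_{H\cap{}^xK}\,\mathrm{Iso}(c_x)\,\mathrm{Res}^K_{H^x\cap K}$. (d) For $M,N\trianglelefteq G$ with $M\cap N=1$: $\mathrm{Defl}^G_{G/N}\mathrm{Infl}^G_{G/M}=\mathrm{Infl}^{G/N}_{G/MN}\mathrm{Defl}^{G/M}_{G/MN}$. (e) For $H\le G$ and $N\trianglelefteq G$, with $f\colon H/(H\cap N)\to HN/N$ the canonical isomorphism: $\mathrm{Defl}^G_{G/N}\mathrm{Ind}^G_H=\mathrm{Ind}^{G/N}_{HN/N}\mathrm{Iso}(f)\mathrm{Defl}^H_{H/H\cap N}$ and $\mathrm{Res}^G_H\mathrm{Infl}^G_{G/N}=\mathrm{Infl}^H_{H/H\cap N}\mathrm{Iso}(f^{-1})\mathrm{Res}^{G/N}_{HN/N}$. (f) For $N\le H\le G$ with $N\trianglelefteq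 G$: $\mathrm{Res}^{G/N}_{H/N}\mathrm{Defl}^G_{G/N}=\mathrm{Defl}^H_{H/N}\mathrm{Res}^G_H$ and $\mathrm{Ind}^G_H\mathrm{Infl}^H_{H/N}=\mathrm{Infl}^G_{G/N}\mathrm{Ind}^{G/N}_{H/N}$. -/

import Mathlib

open CategoryTheory

namespace SpanPres

/-- A finite groupoid: finitely many objects and finitely many arrows. -/
structure FinGpd : Type 1 where
  carrier : Type
  [groupoid : Groupoid.{0} carrier]
  [finite_obj : Finite carrier]
  [finite_hom : ∀ x y : carrier, Finite (x ⟶ y)]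

instance : CoeSort FinGpd Type := ⟨FinGpd.carrier⟩

attribute [instance] FinGpd.groupoid FinGpd.finite_obj FinGpd.finite_hom

section Groupoids

variable {A B C : Type} [Groupoid.{0} A] [Groupoid.{0} B] [Groupoid.{0} C]

/-- For functors between groupoids the comma category is the iso-comma category: every arrow
`L.obj x ⟶ R.obj y` is invertible. It is again a groupoid. -/
instance commaGroupoid (L : A ⥤ C) (R : B ⥤ C) : Groupoid.{0} (Comma L R) where
  inv {X Y} f :=
    { left := Groupoid.inv f.left
      right := Groupoid.inv f.right
      w := by
        have h := f.w
        simp only [Groupoid.inv_eq_inv, Functor.map_inv]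
        rw [IsIso.inv_comp_eq, ← Category.assoc, h, Category.assoc, IsIso.hom_inv_id,
          Category.comp_id] }
  inv_comp f := by
    apply Comma.hom_ext <;> simp
  comp_inv f := by
    apply Comma.hom_ext <;> simp

instance commaFiniteObj (L : A ⥤ C) (R : B ⥤ C) [Finite A] [Finite B]
    [∀ x y : C, Finite (x ⟶ y)] : Finite (Comma L R) :=
  Finite.of_injective
    (fun X : Comma L R => (⟨X.left, X.right, X.hom⟩ : Σ a : A, Σ b : B, (L.obj a ⟶ R.obj b)))
    (by rintro ⟨⟩ ⟨⟩ h; cases h; rfl)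

instance commaFiniteHom (L : A ⥤ C) (R : B ⥤ C) [∀ x y : A, Finite (x ⟶ y)]
    [∀ x y : B, Finite (x ⟶ y)] (X Y : Comma L R) : Finite (X ⟶ Y) :=
  Finite.of_injective
    (fun f : X ⟶ Y => ((f.left, f.right) : (X.left ⟶ Y.left) × (X.right ⟶ Y.right)))
    (by
      intro f g h
      simp only [Prod.mk.injEq] at h
      exact Comma.hom_ext _ _ h.1 h.2)

/-- The disjoint union of two groupoids is a groupoid. -/
instance sumGroupoid : Groupoid.{0} (A ⊕ B) where
  inv {X Y} f :=
    match X, Y, f with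
    | .inl _, .inl _, f => ULift.up (Groupoid.inv f.down)
    | .inr _, .inr _, f => ULift.up (Groupoid.inv f.down)
  inv_comp {X Y} f :=
    match X, Y, f with
    | .inl _, .inl _, f => congrArg ULift.up (Groupoid.inv_comp f.down)
    | .inr _, .inr _, f => congrArg ULift.up (Groupoid.inv_comp f.down)
  comp_inv {X Y} f :=
    match X, Y, f with
    | .inl _, .inl _, f => congrArg ULift.up (Groupoid.comp_inv f.down)
    | .inr _, .inr _, f => congrArg ULift.up (Groupoid.comp_inv f.down)

instance sumFiniteHom [∀ x y : A, Finite (x ⟶ y)] [∀ x y : B, Finite (x ⟶ y)] (X Y : A ⊕ B) :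
    Finite (X ⟶ Y) :=
  match X, Y with
  | .inl a, .inl a' => inferInstanceAs (Finite (ULift (a ⟶ a')))
  | .inr b, .inr b' => inferInstanceAs (Finite (ULift (b ⟶ b')))
  | .inl _, .inr _ => inferInstanceAs (Finite PEmpty)
  | .inr _, .inl _ => inferInstanceAs (Finite PEmpty)

instance emptyGroupoid : Groupoid.{0} (Discrete PEmpty.{1}) where
  inv {X} _ := X.as.elim
  inv_comp {X} _ := X.as.elim
  comp_inv {X} _ := X.as.elim

end Groupoids

/-- The disjoint union of two finite groupoids. -/
abbrev FinGpd.coprod (X Y : FinGpd) : FinGpd := ⟨X ⊕ Y⟩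

/-- The empty groupoid. -/
abbrev FinGpd.empty : FinGpd := ⟨Discrete PEmpty.{1}⟩

/-- The iso-comma groupoid `(F / G)`. -/
abbrev FinGpd.isoComma {X Y Z : FinGpd} (F : X ⥤ Z) (G : Y ⥤ Z) : FinGpd := ⟨Comma F G⟩

/-- A span `X ⟵ mid ⟶ Y` of finite groupoids. -/
structure PreSpan (X Y : FinGpd) : Type 1 where
  mid : FinGpd
  l : mid ⥤ X
  r : mid ⥤ Y

namespace PreSpan

variable {X Y Z W : FinGpd}

/-- Equivalence of spans: an equivalence of the middle groupoids which is compatible with the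
legs up to natural isomorphism. -/
def Equiv (S T : PreSpan X Y) : Prop :=
  ∃ F : S.mid ⥤ T.mid, F.IsEquivalence ∧ Nonempty (S.l ≅ F ⋙ T.l) ∧ Nonempty (S.r ≅ F ⋙ T.r)

/-- The identity span. -/
abbrev id (X : FinGpd) : PreSpan X X := ⟨X, 𝟭 X, 𝟭 X⟩

/-- The composite of spans, through the iso-comma groupoid. -/
abbrev comp (S : PreSpan X Y) (T : PreSpan Y Z) : PreSpan X Z :=
  ⟨FinGpd.isoComma S.r T.l, Comma.fst S.r T.l ⋙ S.l, Comma.snd S.r T.l ⋙ T.r⟩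

/-- The sum of parallel spans: disjoint union of the middle groupoids. -/
abbrev add (S T : PreSpan X Y) : PreSpan X Y :=
  ⟨FinGpd.coprod S.mid T.mid, S.l.sum' T.l, S.r.sum' T.r⟩

/-- The zero span, with empty middle groupoid. -/
abbrev zero (X Y : FinGpd) : PreSpan X Y :=
  ⟨FinGpd.empty, Functor.empty X, Functor.empty Y⟩

theorem Equiv.refl (S : PreSpan X Y) : Equiv S S :=
  ⟨𝟭 _, inferInstance, ⟨(Functor.leftUnitor _).symm⟩, ⟨(Functor.leftUnitor _).symm⟩⟩

theorem Equiv.symm {S T : PreSpan X Y} (h : Equiv S T) : Equiv T S := by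
  obtain ⟨F, hF, ⟨a⟩, ⟨b⟩⟩ := h
  refine ⟨F.inv, inferInstance, ⟨?_⟩, ⟨?_⟩⟩
  · exact (Functor.leftUnitor _).symm ≪≫
      Functor.isoWhiskerRight F.asEquivalence.counitIso.symm T.l ≪≫
      Functor.associator _ _ _ ≪≫ Functor.isoWhiskerLeft F.inv a.symm
  · exact (Functor.leftUnitor _).symm ≪≫
      Functor.isoWhiskerRight F.asEquivalence.counitIso.symm T.r ≪≫
      Functor.associator _ _ _ ≪≫ Functor.isoWhiskerLeft F.inv b.symm

theorem Equiv.trans {S T U : PreSpan X Y} (h : Equiv S T) (h' : Equiv T U) : Equiv S U := by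
  obtain ⟨F, hF, ⟨a⟩, ⟨b⟩⟩ := h
  obtain ⟨G, hG, ⟨a'⟩, ⟨b'⟩⟩ := h'
  exact ⟨F ⋙ G, inferInstance,
    ⟨a ≪≫ Functor.isoWhiskerLeft F a' ≪≫ (Functor.associator _ _ _).symm⟩,
    ⟨b ≪≫ Functor.isoWhiskerLeft F b' ≪≫ (Functor.associator _ _ _).symm⟩⟩

theorem comp_congr {S S' : PreSpan X Y} {T T' : PreSpan Y Z} (h : Equiv S S') (h' : Equiv T T') :
    Equiv (comp S T) (comp S' T') := by
  obtain ⟨F, hF, ⟨a⟩, ⟨b⟩⟩ := h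
  obtain ⟨G, hG, ⟨a'⟩, ⟨b'⟩⟩ := h'
  let α : F ⋙ S'.r ≅ S.r ⋙ 𝟭 _ := b.symm ≪≫ (Functor.rightUnitor _).symm
  let β : T.l ⋙ 𝟭 _ ≅ G ⋙ T'.l := Functor.rightUnitor _ ≪≫ a'
  refine ⟨Comma.map (F₁ := F) (F₂ := G) (F := 𝟭 _) α.hom β.hom, inferInstance, ⟨?_⟩, ⟨?_⟩⟩
  · exact Functor.isoWhiskerLeft (Comma.fst S.r T.l) a
  · exact Functor.isoWhiskerLeft (Comma.snd S.r T.l) b'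

theorem id_comp (S : PreSpan X Y) : Equiv (comp (id X) S) S := by
  refine ⟨Comma.snd (𝟭 X) S.l, ?_, ⟨?_⟩, ⟨Iso.refl _⟩⟩
  · exact
      { faithful := ⟨fun {P Q} f g h => by
          have h' : f.right = g.right := h
          refine Comma.hom_ext _ _ ?_ h'
          have h1 := f.w
          have h2 := g.w
          rw [h'] at h1
          rw [← h2] at h1
          exact (cancel_mono Q.hom).1 h1⟩
        full := ⟨fun {P Q} f =>
          ⟨{ left := P.hom ≫ S.l.map f ≫ inv Q.hom, right := f, w := by simp }, rfl⟩⟩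
        essSurj := ⟨fun y => ⟨⟨S.l.obj y, y, 𝟙 _⟩, ⟨Iso.refl _⟩⟩⟩ }
  · exact NatIso.ofComponents (fun P : Comma _ _ => asIso P.hom)
      (fun {P Q} f => CommaMorphism.w (X := P) (Y := Q) f)

theorem comp_id (S : PreSpan X Y) : Equiv (comp S (id Y)) S := by
  refine ⟨Comma.fst S.r (𝟭 Y), ?_, ⟨Iso.refl _⟩, ⟨?_⟩⟩
  · exact
      { faithful := ⟨fun {P Q} f g h => by
          have h' : f.left = g.left := h
          refine Comma.hom_ext _ _ h' ?_
          have h1 := f.w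
          have h2 := g.w
          rw [h'] at h1
          rw [h1] at h2
          exact (cancel_epi P.hom).1 h2⟩
        full := ⟨fun {P Q} f =>
          ⟨{ left := f, right := inv P.hom ≫ S.r.map f ≫ Q.hom, w := by simp }, rfl⟩⟩
        essSurj := ⟨fun y => ⟨⟨y, S.r.obj y, 𝟙 _⟩, ⟨Iso.refl _⟩⟩⟩ }
  · exact (NatIso.ofComponents (fun P : Comma _ _ => asIso P.hom)
      (fun {P Q} f => CommaMorphism.w (X := P) (Y := Q) f)).symm

theorem assoc (S : PreSpan X Y) (T : PreSpan Y Z) (U : PreSpan Z W) :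
    Equiv (comp (comp S T) U) (comp S (comp T U)) := by
  let F : Comma (Comma.snd S.r T.l ⋙ T.r) U.l ⥤ Comma S.r (Comma.fst T.r U.l ⋙ T.l) :=
    { obj := fun P => ⟨P.left.left, ⟨P.left.right, P.right, P.hom⟩, P.left.hom⟩
      map := fun f =>
        { left := f.left.left
          right := { left := f.left.right, right := f.right, w := f.w }
          w := f.left.w } }
  refine ⟨F, ?_, ⟨Iso.refl _⟩, ⟨Iso.refl _⟩⟩
  exact
    { faithful := ⟨fun {P Q} f g h => by
        have h1 := congrArg CommaMorphism.left h
        have h2 := congrArg (fun u => CommaMorphism.left (CommaMorphism.right u)) h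
        have h3 := congrArg (fun u => CommaMorphism.right (CommaMorphism.right u)) h
        exact Comma.hom_ext _ _ (Comma.hom_ext _ _ h1 h2) h3⟩
      full := ⟨fun {P Q} f =>
        ⟨{ left := { left := f.left, right := f.right.left, w := f.w }
           right := f.right.right
           w := f.right.w }, rfl⟩⟩
      essSurj := ⟨fun P =>
        ⟨⟨⟨P.left, P.right.left, P.hom⟩, P.right.right, P.right.hom⟩, ⟨Iso.refl _⟩⟩⟩ }

/-- Naturally isomorphic functors out of a disjoint union, from the two pieces. -/
theorem sum'_comp {A B A' B' C : Type} [Groupoid.{0} A] [Groupoid.{0} B] [Groupoid.{0} A']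
    [Groupoid.{0} B'] [Groupoid.{0} C] {L : A ⥤ C} {R : B ⥤ C} {L' : A' ⥤ C} {R' : B' ⥤ C}
    {F : A ⥤ A'} {G : B ⥤ B'} (a : L ≅ F ⋙ L') (b : R ≅ G ⋙ R') :
    Nonempty (L.sum' R ≅ F.sum G ⋙ L'.sum' R') :=
  ⟨Functor.sumIsoExt (NatIso.ofComponents (fun x => a.app x) (fun f => a.hom.naturality f))
    (NatIso.ofComponents (fun x => b.app x) (fun f => b.hom.naturality f))⟩

theorem sum_isEquivalence {A B A' B' : Type} [Groupoid.{0} A] [Groupoid.{0} B] [Groupoid.{0} A']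
    [Groupoid.{0} B'] (F : A ⥤ A') (G : B ⥤ B') [F.IsEquivalence] [G.IsEquivalence] :
    (F.sum G).IsEquivalence :=
  { faithful := ⟨fun {P Q} f g h => by
      rcases P with P | P <;> rcases Q with Q | Q
      · exact congrArg ULift.up (F.map_injective (congrArg ULift.down h))
      · exact f.elim
      · exact f.elim
      · exact congrArg ULift.up (G.map_injective (congrArg ULift.down h))⟩
    full := ⟨fun {P Q} f => by
      rcases P with P | P <;> rcases Q with Q | Q
      · exact ⟨ULift.up (F.preimage f.down), congrArg ULift.up (F.map_preimage f.down)⟩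
      · exact PEmpty.elim f
      · exact PEmpty.elim f
      · exact ⟨ULift.up (G.preimage f.down), congrArg ULift.up (G.map_preimage f.down)⟩⟩
    essSurj := ⟨fun P => by
      rcases P with P | P
      · exact ⟨.inl (F.objPreimage P), ⟨(CategoryTheory.Sum.inl_ A' B').mapIso (F.objObjPreimageIso P)⟩⟩
      · exact ⟨.inr (G.objPreimage P), ⟨(CategoryTheory.Sum.inr_ A' B').mapIso (G.objObjPreimageIso P)⟩⟩⟩ }

theorem add_congr {S S' T T' : PreSpan X Y} (h : Equiv S S') (h' : Equiv T T') :
    Equiv (add S T) (add S' T') := by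
  obtain ⟨F, hF, ⟨a⟩, ⟨b⟩⟩ := h
  obtain ⟨G, hG, ⟨a'⟩, ⟨b'⟩⟩ := h'
  exact ⟨F.sum G, sum_isEquivalence F G, sum'_comp a a', sum'_comp b b'⟩

theorem add_comm (S T : PreSpan X Y) : Equiv (add S T) (add T S) :=
  ⟨CategoryTheory.Sum.swap _ _, inferInstance,
    ⟨Functor.sumIsoExt (Iso.refl _) (Iso.refl _)⟩, ⟨Functor.sumIsoExt (Iso.refl _) (Iso.refl _)⟩⟩

theorem add_assoc (S T U : PreSpan X Y) : Equiv (add (add S T) U) (add S (add T U)) :=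
  ⟨CategoryTheory.sum.associator _ _ _, inferInstance,
    ⟨Functor.sumIsoExt (Functor.sumIsoExt (Iso.refl _) (Iso.refl _)) (Iso.refl _)⟩,
    ⟨Functor.sumIsoExt (Functor.sumIsoExt (Iso.refl _) (Iso.refl _)) (Iso.refl _)⟩⟩

theorem add_zero (S : PreSpan X Y) : Equiv (add S (zero X Y)) S :=
  Equiv.symm ⟨CategoryTheory.Sum.inl_ _ _,
    { faithful := ⟨fun {_ _} _ _ h => congrArg ULift.down h⟩
      full := ⟨fun f => ⟨f.down, rfl⟩⟩
      essSurj := ⟨fun P => by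
        rcases P with P | P
        · exact ⟨P, ⟨Iso.refl _⟩⟩
        · exact P.as.elim⟩ },
    ⟨(Functor.inlCompSum' _ _).symm⟩, ⟨(Functor.inlCompSum' _ _).symm⟩⟩

theorem add_comp (S S' : PreSpan X Y) (T : PreSpan Y Z) :
    Equiv (add (comp S T) (comp S' T)) (comp (add S S') T) := by
  let F : Comma S.r T.l ⥤ Comma (S.r.sum' S'.r) T.l :=
    { obj := fun P => ⟨.inl P.left, P.right, P.hom⟩
      map := fun f => { left := ULift.up f.left, right := f.right, w := f.w }
      map_id := fun _ => rfl
      map_comp := fun _ _ => rfl }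
  let G : Comma S'.r T.l ⥤ Comma (S.r.sum' S'.r) T.l :=
    { obj := fun P => ⟨.inr P.left, P.right, P.hom⟩
      map := fun f => { left := ULift.up f.left, right := f.right, w := f.w }
      map_id := fun _ => rfl
      map_comp := fun _ _ => rfl }
  refine ⟨F.sum' G, ?_, ⟨?_⟩, ⟨?_⟩⟩
  · exact
      { faithful := ⟨fun {P Q} f g h => by
          rcases P with P | P <;> rcases Q with Q | Q
          · exact congrArg ULift.up (Comma.hom_ext _ _
              (congrArg (fun u => ULift.down (CommaMorphism.left u)) h)
              (congrArg CommaMorphism.right h :))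
          · exact f.elim
          · exact f.elim
          · exact congrArg ULift.up (Comma.hom_ext _ _
              (congrArg (fun u => ULift.down (CommaMorphism.left u)) h)
              (congrArg CommaMorphism.right h :))⟩
        full := ⟨fun {P Q} f => by
          rcases P with P | P <;> rcases Q with Q | Q
          · exact ⟨ULift.up { left := f.left.down, right := f.right, w := f.w }, rfl⟩
          · exact PEmpty.elim f.left
          · exact PEmpty.elim f.left
          · exact ⟨ULift.up { left := f.left.down, right := f.right, w := f.w }, rfl⟩⟩
        essSurj := ⟨fun P => by
          obtain ⟨P | P, Q, f⟩ := P
          · exact ⟨.inl ⟨P, Q, f⟩, ⟨Iso.refl _⟩⟩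
          · exact ⟨.inr ⟨P, Q, f⟩, ⟨Iso.refl _⟩⟩⟩ }
  · exact Functor.sumIsoExt (Iso.refl _) (Iso.refl _)
  · exact Functor.sumIsoExt (Iso.refl _) (Iso.refl _)

theorem comp_add (S : PreSpan X Y) (T T' : PreSpan Y Z) :
    Equiv (add (comp S T) (comp S T')) (comp S (add T T')) := by
  let F : Comma S.r T.l ⥤ Comma S.r (T.l.sum' T'.l) :=
    { obj := fun P => ⟨P.left, .inl P.right, P.hom⟩
      map := fun f => { left := f.left, right := ULift.up f.right, w := f.w }
      map_id := fun _ => rfl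
      map_comp := fun _ _ => rfl }
  let G : Comma S.r T'.l ⥤ Comma S.r (T.l.sum' T'.l) :=
    { obj := fun P => ⟨P.left, .inr P.right, P.hom⟩
      map := fun f => { left := f.left, right := ULift.up f.right, w := f.w }
      map_id := fun _ => rfl
      map_comp := fun _ _ => rfl }
  refine ⟨F.sum' G, ?_, ⟨?_⟩, ⟨?_⟩⟩
  · exact
      { faithful := ⟨fun {P Q} f g h => by
          rcases P with P | P <;> rcases Q with Q | Q
          · exact congrArg ULift.up (Comma.hom_ext _ _ (congrArg CommaMorphism.left h :)
              (congrArg (fun u => ULift.down (CommaMorphism.right u)) h))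
          · exact f.elim
          · exact f.elim
          · exact congrArg ULift.up (Comma.hom_ext _ _ (congrArg CommaMorphism.left h :)
              (congrArg (fun u => ULift.down (CommaMorphism.right u)) h))⟩
        full := ⟨fun {P Q} f => by
          rcases P with P | P <;> rcases Q with Q | Q
          · exact ⟨ULift.up { left := f.left, right := f.right.down, w := f.w }, rfl⟩
          · exact PEmpty.elim f.right
          · exact PEmpty.elim f.right
          · exact ⟨ULift.up { left := f.left, right := f.right.down, w := f.w }, rfl⟩⟩
        essSurj := ⟨fun P => by
          obtain ⟨Q, P | P, f⟩ := P
          · exact ⟨.inl ⟨Q, P, f⟩, ⟨Iso.refl _⟩⟩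
          · exact ⟨.inr ⟨Q, P, f⟩, ⟨Iso.refl _⟩⟩⟩ }
  · exact Functor.sumIsoExt (Iso.refl _) (Iso.refl _)
  · exact Functor.sumIsoExt (Iso.refl _) (Iso.refl _)

/-- Any two spans with empty middle groupoids are equivalent. -/
theorem equiv_of_isEmpty (S T : PreSpan X Y) (hS : S.mid → False) (hT : T.mid → False) :
    Equiv S T :=
  ⟨{ obj := fun x => (hS x).elim
     map := fun {x} _ => (hS x).elim
     map_id := fun x => (hS x).elim
     map_comp := fun {x} _ _ => (hS x).elim },
    { faithful := ⟨fun {x} _ _ _ _ => (hS x).elim⟩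
      full := ⟨fun {x} _ _ => (hS x).elim⟩
      essSurj := ⟨fun x => (hT x).elim⟩ },
    ⟨NatIso.ofComponents (fun x => (hS x).elim) (fun {x} => (hS x).elim)⟩,
    ⟨NatIso.ofComponents (fun x => (hS x).elim) (fun {x} => (hS x).elim)⟩⟩

theorem zero_comp (T : PreSpan Y Z) : Equiv (comp (zero X Y) T) (zero X Z) :=
  equiv_of_isEmpty _ _ (fun P => P.left.as.elim) (fun P => P.as.elim)

theorem comp_zero (S : PreSpan X Y) : Equiv (comp S (zero Y Z)) (zero X Z) :=
  equiv_of_isEmpty _ _ (fun P => P.right.as.elim) (fun P => P.as.elim)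

/-- Equivalence of spans as a setoid. -/
instance setoid (X Y : FinGpd) : Setoid (PreSpan X Y) :=
  ⟨Equiv, Equiv.refl, Equiv.symm, Equiv.trans⟩

end PreSpan

/-- The category of spans of finite groupoids: a morphism `X ⟶ Y` is an equivalence class of spans
`X ⟵ S ⟶ Y`. -/
instance spanCategory : Category.{1} FinGpd where
  Hom X Y := Quotient (PreSpan.setoid X Y)
  id X := Quotient.mk _ (PreSpan.id X)
  comp := Quotient.map₂ PreSpan.comp (fun _ _ h _ _ h' => PreSpan.comp_congr h h')
  id_comp := by rintro X Y ⟨S⟩; exact Quotient.sound (PreSpan.id_comp S)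
  comp_id := by rintro X Y ⟨S⟩; exact Quotient.sound (PreSpan.comp_id S)
  assoc := by rintro X Y Z W ⟨S⟩ ⟨T⟩ ⟨U⟩; exact Quotient.sound (PreSpan.assoc S T U)

/-- The class of a span. -/
def PreSpan.cls {X Y : FinGpd} (S : PreSpan X Y) : X ⟶ Y := Quotient.mk _ S

/-- The sum of classes of parallel spans. -/
instance spanAdd (X Y : FinGpd) : Add (X ⟶ Y) :=
  ⟨Quotient.map₂ PreSpan.add (fun _ _ h _ _ h' => PreSpan.add_congr h h')⟩

/-- The zero morphism: the class of the span with empty middle groupoid. -/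
instance spanZero (X Y : FinGpd) : Zero (X ⟶ Y) := ⟨(PreSpan.zero X Y).cls⟩

instance spanAddCommMonoid (X Y : FinGpd) : AddCommMonoid (X ⟶ Y) where
  add_assoc := by rintro ⟨S⟩ ⟨T⟩ ⟨U⟩; exact Quotient.sound (PreSpan.add_assoc S T U)
  add_comm := by rintro ⟨S⟩ ⟨T⟩; exact Quotient.sound (PreSpan.add_comm S T)
  add_zero := by rintro ⟨S⟩; exact Quotient.sound (PreSpan.add_zero S)
  zero_add := by
    rintro ⟨S⟩
    exact Quotient.sound ((PreSpan.add_comm _ S).trans (PreSpan.add_zero S))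
  nsmul := nsmulRec

/-- A category enriched in commutative additive monoids. -/
class AddMonEnriched (C : Type*) [Category C] where
  homAdd : ∀ X Y : C, AddCommMonoid (X ⟶ Y)
  add_comp : ∀ {X Y Z : C} (f f' : X ⟶ Y) (g : Y ⟶ Z), (f + f') ≫ g = f ≫ g + f' ≫ g
  comp_add : ∀ {X Y Z : C} (f : X ⟶ Y) (g g' : Y ⟶ Z), f ≫ (g + g') = f ≫ g + f ≫ g'
  zero_comp : ∀ {X Y Z : C} (g : Y ⟶ Z), (0 : X ⟶ Y) ≫ g = 0
  comp_zero : ∀ {X Y Z : C} (f : X ⟶ Y), f ≫ (0 : Y ⟶ Z) = 0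

attribute [reducible] AddMonEnriched.homAdd
attribute [instance] AddMonEnriched.homAdd

instance spanAddMonEnriched : AddMonEnriched FinGpd where
  homAdd := spanAddCommMonoid
  add_comp := by
    rintro X Y Z ⟨S⟩ ⟨S'⟩ ⟨T⟩; exact (Quotient.sound (PreSpan.add_comp S S' T)).symm
  comp_add := by
    rintro X Y Z ⟨S⟩ ⟨T⟩ ⟨T'⟩; exact (Quotient.sound (PreSpan.comp_add S T T')).symm
  zero_comp := by rintro X Y Z ⟨T⟩; exact Quotient.sound (PreSpan.zero_comp T)
  comp_zero := by rintro X Y Z ⟨S⟩; exact Quotient.sound (PreSpan.comp_zero S)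

section Linearization

open TensorProduct Algebra


/-- The `k`-linearization of a category `C` enriched in commutative monoids: the same objects, and
`k ⊗[ℤ] (X ⟶ Y)^±` as morphisms, where `(X ⟶ Y)^±` is the group completion of `X ⟶ Y`. -/
structure KLin (k C : Type*) where
  as : C

namespace KLin

variable (k : Type*) [CommRing k] {C : Type*} [Category C] [AddMonEnriched C]

/-- The `k`-module of morphisms of the `k`-linearization. -/
abbrev Hom (X Y : C) := k ⊗[ℤ] GrothendieckAddGroup (X ⟶ Y)

/-- The canonical map of a Hom monoid to its `k`-linearization. -/
def ι {X Y : C} (f : X ⟶ Y) : Hom k X Y := 1 ⊗ₜ GrothendieckAddGroup.of f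

theorem gr_lift_of {M G : Type*} [AddCommMonoid M] [AddCommGroup G] (f : M →+ G) (m : M) :
    GrothendieckAddGroup.lift f (GrothendieckAddGroup.of m) = f m :=
  DFunLike.congr_fun (GrothendieckAddGroup.lift.symm_apply_apply f) m

theorem gr_hom_ext {M G : Type*} [AddCommMonoid M] [AddCommGroup G]
    {f g : GrothendieckAddGroup M →+ G}
    (h : ∀ m : M, f (GrothendieckAddGroup.of m) = g (GrothendieckAddGroup.of m)) : f = g :=
  GrothendieckAddGroup.lift.symm.injective (AddMonoidHom.ext h)

/-- Composition on the group completions: the biadditive extension of the composition of `C`. -/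
noncomputable def grComp (X Y Z : C) :
    GrothendieckAddGroup (X ⟶ Y) →+ GrothendieckAddGroup (Y ⟶ Z) →+
      GrothendieckAddGroup (X ⟶ Z) :=
  GrothendieckAddGroup.lift
    { toFun := fun f => GrothendieckAddGroup.lift
        { toFun := fun g => GrothendieckAddGroup.of (f ≫ g)
          map_zero' := by rw [AddMonEnriched.comp_zero, map_zero]
          map_add' := fun g g' => by rw [AddMonEnriched.comp_add, map_add] }
      map_zero' := gr_hom_ext fun g => by
        rw [gr_lift_of]
        simp only [AddMonoidHom.coe_mk, ZeroHom.coe_mk, AddMonEnriched.zero_comp, map_zero,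
          AddMonoidHom.zero_apply]
      map_add' := fun f f' => gr_hom_ext fun g => by
        rw [AddMonoidHom.add_apply, gr_lift_of, gr_lift_of, gr_lift_of]
        simp only [AddMonoidHom.coe_mk, ZeroHom.coe_mk, AddMonEnriched.add_comp, map_add] }

theorem grComp_of {X Y Z : C} (f : X ⟶ Y) (g : Y ⟶ Z) :
    grComp X Y Z (GrothendieckAddGroup.of f) (GrothendieckAddGroup.of g) =
      GrothendieckAddGroup.of (f ≫ g) := by
  rw [grComp, gr_lift_of]
  exact gr_lift_of _ g

/-- Composition of the `k`-linearization: the `k`-bilinear extension of the composition. -/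
noncomputable def compLin (X Y Z : C) : Hom k X Y →ₗ[k] Hom k Y Z →ₗ[k] Hom k X Z :=
  LinearMap.liftBaseChange k
    ((LinearMap.baseChangeHom ℤ k (GrothendieckAddGroup (Y ⟶ Z))
      (GrothendieckAddGroup (X ⟶ Z))).comp
      ({ toFun := fun f => (grComp X Y Z f).toIntLinearMap
         map_zero' := by rw [map_zero]; rfl
         map_add' := fun f f' => by rw [map_add]; rfl } :
        GrothendieckAddGroup (X ⟶ Y) →+
          GrothendieckAddGroup (Y ⟶ Z) →ₗ[ℤ] GrothendieckAddGroup (X ⟶ Z)).toIntLinearMap)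

theorem compLin_ι {X Y Z : C} (f : X ⟶ Y) (g : Y ⟶ Z) :
    compLin k X Y Z (ι k f) (ι k g) = ι k (f ≫ g) := by
  simp only [compLin, ι, LinearMap.liftBaseChange_tmul, LinearMap.comp_apply, one_smul]
  exact (LinearMap.baseChange_tmul _ _ _).trans (congrArg _ (grComp_of f g))

theorem hom_ext {X Y : C} {M : Type*} [AddCommGroup M] [Module k M] {f g : Hom k X Y →ₗ[k] M}
    (h : ∀ m : X ⟶ Y, f (ι k m) = g (ι k m)) : f = g := by
  apply (LinearMap.liftBaseChangeEquiv k).symm.injective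
  apply LinearMap.toAddMonoidHom_injective
  exact gr_hom_ext h

/-- The `k`-linearization is a category. -/
noncomputable instance category : Category (KLin k C) where
  Hom X Y := Hom k X.as Y.as
  id X := ι k (𝟙 X.as)
  comp {X Y Z} f g := compLin k X.as Y.as Z.as f g
  id_comp {X Y} f := by
    have : compLin k X.as X.as Y.as (ι k (𝟙 X.as)) = LinearMap.id :=
      hom_ext k fun m => by rw [compLin_ι, Category.id_comp]; rfl
    exact DFunLike.congr_fun this f
  comp_id {X Y} f := by
    have : (compLin k X.as Y.as Y.as).flip (ι k (𝟙 Y.as)) = LinearMap.id :=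
      hom_ext k fun m => by rw [LinearMap.flip_apply, compLin_ι, Category.comp_id]; rfl
    exact DFunLike.congr_fun this f
  assoc {W X Y Z} f g h := by
    have h1 : ∀ (m : W.as ⟶ X.as) (n : X.as ⟶ Y.as),
        compLin k _ _ Z.as (compLin k _ _ _ (ι k m) (ι k n)) =
          (compLin k _ _ Z.as (ι k m)).comp (compLin k _ _ Z.as (ι k n)) := fun m n =>
      hom_ext k fun p => by
        simp only [LinearMap.comp_apply, compLin_ι, Category.assoc]
    have h2 : ∀ m : W.as ⟶ X.as,
        ((compLin k W.as Y.as Z.as).flip h).comp (compLin k _ _ _ (ι k m)) =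
          (compLin k W.as X.as Z.as (ι k m)).comp ((compLin k X.as Y.as Z.as).flip h) := fun m =>
      hom_ext k fun n => by
        simp only [LinearMap.comp_apply, LinearMap.flip_apply, h1]
    have h3 : ((compLin k W.as Y.as Z.as).flip h).comp ((compLin k W.as X.as Y.as).flip g) =
        (compLin k W.as X.as Z.as).flip (compLin k _ _ _ g h) :=
      hom_ext k fun m => DFunLike.congr_fun (h2 m) g
    exact DFunLike.congr_fun h3 f

noncomputable instance preadditive : Preadditive (KLin k C) where
  homGroup X Y := inferInstanceAs (AddCommGroup (Hom k X.as Y.as))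
  add_comp X Y Z f f' g := LinearMap.map_add₂ (compLin k X.as Y.as Z.as) f f' g
  comp_add X Y Z f g g' := (compLin k X.as Y.as Z.as f).map_add g g'

noncomputable instance linear : Linear k (KLin k C) where
  homModule X Y := inferInstanceAs (Module k (Hom k X.as Y.as))
  smul_comp X Y Z a f g := LinearMap.map_smul₂ (compLin k X.as Y.as Z.as) a f g
  comp_smul X Y Z f a g := (compLin k X.as Y.as Z.as f).map_smul a g

end KLin
end Linearization

section FreeLift

variable (k : Type*) [CommRing k] {C D : Type*} [Category C] [Category D] [Preadditive D]
  [Linear k D]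

/-- The `k`-linear extension of a functor to formal `k`-linear combinations of morphisms. -/
noncomputable def freeLiftMap (F : C ⥤ D) (X Y : C) : ((X ⟶ Y) →₀ k) →ₗ[k] (F.obj X ⟶ F.obj Y) :=
  Finsupp.linearCombination k (fun p : X ⟶ Y => F.map p)

theorem freeLiftMap_comp (F : C ⥤ D) (X Y Z : C) (f : (X ⟶ Y) →₀ k) (g : (Y ⟶ Z) →₀ k) :
    freeLiftMap k F X Z (f.sum fun f' s => g.sum fun g' t => Finsupp.single (f' ≫ g') (s * t)) =
      freeLiftMap k F X Y f ≫ freeLiftMap k F Y Z g := by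
  simp only [freeLiftMap]
  rw [map_finsuppSum, Finsupp.linearCombination_apply, Finsupp.linearCombination_apply,
    Finsupp.sum, Finsupp.sum, Finsupp.sum, Preadditive.sum_comp]
  refine Finset.sum_congr rfl fun p _ => ?_
  rw [map_finsuppSum, Preadditive.comp_sum]
  refine Finset.sum_congr rfl fun q _ => ?_
  beta_reduce
  rw [Finsupp.linearCombination_single, Linear.smul_comp, Linear.comp_smul, smul_smul,
    Functor.map_comp]

/-- The `k`-linear extension of a functor to the free `k`-linear category on its source. -/
noncomputable def freeLift (F : C ⥤ D) : Free k C ⥤ D where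
  obj X := F.obj X
  map {X Y} f := freeLiftMap k F X Y f
  map_id X := by
    refine (Finsupp.linearCombination_single k _ _).trans ?_
    rw [one_smul]
    exact F.map_id X
  map_comp {X Y Z} f g := freeLiftMap_comp k F X Y Z f g

theorem freeLift_map_embedding (F : C ⥤ D) {X Y : C} (p : X ⟶ Y) :
    (freeLift k F).map ((Free.embedding k C).map p) = F.map p := by
  have h : freeLiftMap k F X Y (Finsupp.single p 1) = F.map p := by
    rw [freeLiftMap, Finsupp.linearCombination_single, one_smul]
  exact h

instance freeLift_additive (F : C ⥤ D) : (freeLift k F).Additive where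
  map_add {X Y} f g := (freeLiftMap k F X Y).map_add f g

instance freeLift_linear (F : C ⥤ D) : (freeLift k F).Linear k where
  map_smul {X Y} f a := (freeLiftMap k F X Y).map_smul a f

end FreeLift

/-- The `k`-linear category of spans of finite groupoids. -/
abbrev SpanCat (k : Type*) [CommRing k] := KLin k FinGpd

/-- A finite group. -/
structure FinGp : Type 1 where
  of ::
  carrier : Type
  [group : Group carrier]
  [finite : Finite carrier]

attribute [instance] FinGp.group FinGp.finite

/-- A finite group as a groupoid with one object. -/
abbrev FinGp.toGpd (G : FinGp) : FinGpd :=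
  { carrier := SingleObj G.carrier
    finite_obj := inferInstanceAs (Finite Unit)
    finite_hom := fun _ _ => inferInstanceAs (Finite G.carrier) }

/-- The names of the elementary spans between finite groups. -/
inductive Elem : FinGp → FinGp → Type 1
  | res {G : Type} [Group G] [Finite G] (H : Subgroup G) : Elem (.of G) (.of H)
  | ind {G : Type} [Group G] [Finite G] (H : Subgroup G) : Elem (.of H) (.of G)
  | infl {G : Type} [Group G] [Finite G] (N : Subgroup G) [N.Normal] : Elem (.of (G ⧸ N)) (.of G)
  | defl {G : Type} [Group G] [Finite G] (N : Subgroup G) [N.Normal] : Elem (.of G) (.of (G ⧸ N))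
  | iso {G G' : Type} [Group G] [Finite G] [Group G'] [Finite G'] (f : G ≃* G') :
      Elem (.of G) (.of G')

/-- The span `[G ⟵ H = H]` of a homomorphism `u : H →* G`. -/
abbrev pullSpan {H G : Type} [Group H] [Finite H] [Group G] [Finite G] (u : H →* G) :
    PreSpan (FinGp.of G).toGpd (FinGp.of H).toGpd :=
  ⟨(FinGp.of H).toGpd, u.toFunctor, 𝟭 _⟩

/-- The span `[H = H ⟶ G]` of a homomorphism `u : H →* G`. -/
abbrev pushSpan {H G : Type} [Group H] [Finite H] [Group G] [Finite G] (u : H →* G) :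
    PreSpan (FinGp.of H).toGpd (FinGp.of G).toGpd :=
  ⟨(FinGp.of H).toGpd, 𝟭 _, u.toFunctor⟩

/-- The elementary spans: restrictions `[G ⟵ H = H]`, inductions `[H = H ⟶ G]`, inflations
`[G ⧸ N ⟵ G = G]`, deflations `[G = G ⟶ G ⧸ N]` and isomorphisms `[G = G ⟶ G']`. -/
def Elem.span : {G H : FinGp} → Elem G H → PreSpan G.toGpd H.toGpd
  | _, _, @Elem.res G _ _ H => pullSpan (H := H) (G := G) H.subtype
  | _, _, @Elem.ind G _ _ H => pushSpan (H := H) (G := G) H.subtype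
  | _, _, @Elem.infl G _ _ N _ => pullSpan (H := G) (G := G ⧸ N) (QuotientGroup.mk' N)
  | _, _, @Elem.defl G _ _ N _ => pushSpan (H := G) (G := G ⧸ N) (QuotientGroup.mk' N)
  | _, _, @Elem.iso G G' _ _ _ _ f => pushSpan (H := G) (G := G') f.toMonoidHom

/-- The quiver with finite groups as vertices and names of elementary spans as arrows. -/
instance elemQuiver : Quiver.{1} FinGp := ⟨Elem⟩

/-- The free `k`-linear category on the elementary spans: morphisms are formal `k`-linear
combinations of composable finite strings of elementary spans. -/
abbrev FreeSpan (k : Type*) [CommRing k] := Free k (Paths FinGp)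

section Isomorphisms

variable {G : Type} [Group G]

/-- The subgroup `H ∩ ˣK` of `H`, where `ˣK = x K x⁻¹`. -/
def interConj (H K : Subgroup G) (x : G) : Subgroup H :=
  (K.map (MulAut.conj x).toMonoidHom).subgroupOf H

/-- The subgroup `Hˣ ∩ K` of `K`, where `Hˣ = x⁻¹ H x`. -/
def conjInter (H K : Subgroup G) (x : G) : Subgroup K :=
  (H.map (MulAut.conj x⁻¹).toMonoidHom).subgroupOf K

/-- The conjugation isomorphism `Hˣ ∩ K ≃* H ∩ ˣK`, `g ↦ x g x⁻¹`. -/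
def conjIso (H K : Subgroup G) (x : G) : conjInter H K x ≃* interConj H K x where
  toFun g := ⟨⟨x * g.1.1 * x⁻¹, by
      obtain ⟨h, hh, e⟩ := Subgroup.mem_subgroupOf.1 g.2
      have e' : x⁻¹ * h * x = g.1.1 := by simpa using e
      rw [← e']
      simpa [mul_assoc] using hh⟩,
    Subgroup.mem_subgroupOf.2 ⟨g.1.1, g.1.2, by simp⟩⟩
  invFun g := ⟨⟨x⁻¹ * g.1.1 * x, by
      obtain ⟨h, hh, e⟩ := Subgroup.mem_subgroupOf.1 g.2
      have e' : x * h * x⁻¹ = g.1.1 := by simpa using e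
      rw [← e']
      simpa [mul_assoc] using hh⟩,
    Subgroup.mem_subgroupOf.2 ⟨g.1.1, g.1.2, by simp⟩⟩
  left_inv g := by
    apply Subtype.ext
    apply Subtype.ext
    simp [mul_assoc]
  right_inv g := by
    apply Subtype.ext
    apply Subtype.ext
    simp [mul_assoc]
  map_mul' g g' := by
    apply Subtype.ext
    apply Subtype.ext
    simp [mul_assoc]

/-- The subgroup `HN/N` of `G/N`: the image of `H` under the quotient map. It is `H/N` if
`N ≤ H`. -/
abbrev imageMod (H N : Subgroup G) [N.Normal] : Subgroup (G ⧸ N) := H.map (QuotientGroup.mk' N)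

/-- The canonical isomorphism `H/(H ∩ N) ≃* HN/N`, `h(H ∩ N) ↦ hN`. -/
noncomputable def quotIso (H N : Subgroup G) [N.Normal] : H ⧸ N.subgroupOf H ≃* imageMod H N :=
  QuotientGroup.liftEquiv (N.subgroupOf H) (φ := (QuotientGroup.mk' N).subgroupMap H)
    (MonoidHom.subgroupMap_surjective _ _) (by
      ext h
      rw [MonoidHom.mem_ker, Subgroup.mem_subgroupOf, Subtype.ext_iff]
      exact (QuotientGroup.eq_one_iff (h : G)).symm)

end Isomorphisms

section Presentation

universe w
variable (k : Type w) [CommRing k]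

/-- The finite group `G` as an object of the free `k`-linear category. -/
abbrev freeObj (G : FinGp) : FreeSpan k := Free.of k ((Paths.of FinGp).obj G)

/-- The finite group `G` as an object of the free `k`-linear category, unbundled version. -/
abbrev gp (G : Type) [Group G] [Finite G] : FreeSpan k := freeObj k (.of G)

/-- An elementary span as a morphism of the free `k`-linear category. -/
noncomputable def gen {G H : FinGp} (e : Elem G H) : freeObj k G ⟶ freeObj k H :=
  (Free.embedding k (Paths FinGp)).map ((Paths.of FinGp).map e)

section Generators

variable {G G' : Type} [Group G] [Finite G] [Group G'] [Finite G']

noncomputable abbrev res (H : Subgroup G) : gp k G ⟶ gp k H := gen k (.res H)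
noncomputable abbrev ind (H : Subgroup G) : gp k H ⟶ gp k G := gen k (.ind H)
noncomputable abbrev infl (N : Subgroup G) [N.Normal] : gp k (G ⧸ N) ⟶ gp k G := gen k (.infl N)
noncomputable abbrev defl (N : Subgroup G) [N.Normal] : gp k G ⟶ gp k (G ⧸ N) := gen k (.defl N)
noncomputable abbrev iso (f : G ≃* G') : gp k G ⟶ gp k G' := gen k (.iso f)

end Generators

/-- A finite group as an object of the span category: the groupoid with one object. -/
abbrev grp (G : FinGp) : SpanCat k := ⟨G.toGpd⟩

/-- The composite in `SpanCat k` of a string of elementary spans. -/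
noncomputable def realizePath : Paths FinGp ⥤ SpanCat k :=
  Paths.lift
    { obj := fun G => grp k G
      map := fun e => KLin.ι k (PreSpan.cls e.span) }

/-- The `k`-linear functor which evaluates a formal `k`-linear combination of strings of elementary
spans in `SpanCat k`. -/
noncomputable def realize : FreeSpan k ⥤ SpanCat k := freeLift k (realizePath k)

instance realize_additive : (realize k).Additive :=
  inferInstanceAs (freeLift k (realizePath k)).Additive

instance realize_linear : (realize k).Linear k :=
  inferInstanceAs ((freeLift k (realizePath k)).Linear k)

/-- The relations between the elementary spans. Composition is written in diagrammatic order: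
`a ≫ b` is `b ∘ a`. The canonical identifications between isomorphic groups, such as `G ⧸ 1 = G`
or `(G ⧸ N) ⧸ (M ⧸ N) = G ⧸ M`, are written as isomorphisms. -/
inductive Rel : ∀ {X Y : FreeSpan k}, (X ⟶ Y) → (X ⟶ Y) → Prop
  -- triviality relations
  | res_top (G : Type) [Group G] [Finite G] :
      Rel (res k (⊤ : Subgroup G)) (iso k (Subgroup.topEquiv (G := G)).symm)
  | ind_top (G : Type) [Group G] [Finite G] :
      Rel (ind k (⊤ : Subgroup G)) (iso k (Subgroup.topEquiv (G := G)))
  | defl_bot (G : Type) [Group G] [Finite G] :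
      Rel (defl k (⊥ : Subgroup G)) (iso k (QuotientGroup.quotientBot (G := G)).symm)
  | infl_bot (G : Type) [Group G] [Finite G] :
      Rel (infl k (⊥ : Subgroup G)) (iso k (QuotientGroup.quotientBot (G := G)))
  | iso_inner {G : Type} [Group G] [Finite G] (x : G) :
      Rel (iso k (MulAut.conj x : G ≃* G)) (𝟙 (gp k G))
  -- transitivity relations
  | res_res {G : Type} [Group G] [Finite G] (K H : Subgroup G) (h : K ≤ H) :
      Rel (res k H ≫ res k (K.subgroupOf H) ≫ iso k (Subgroup.subgroupOfEquivOfLe h)) (res k K)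
  | ind_ind {G : Type} [Group G] [Finite G] (K H : Subgroup G) (h : K ≤ H) :
      Rel (iso k (Subgroup.subgroupOfEquivOfLe h).symm ≫ ind k (K.subgroupOf H) ≫ ind k H)
        (ind k K)
  | iso_iso {G G' G'' : Type} [Group G] [Finite G] [Group G'] [Finite G'] [Group G''] [Finite G'']
      (f : G ≃* G') (f' : G' ≃* G'') : Rel (iso k f ≫ iso k f') (iso k (f.trans f'))
  | infl_infl {G : Type} [Group G] [Finite G] (N M : Subgroup G) [N.Normal] [M.Normal]
      (h : N ≤ M) :
      Rel (iso k (QuotientGroup.quotientQuotientEquivQuotient N M h).symm ≫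
          infl k (M.map (QuotientGroup.mk' N)) ≫ infl k N)
        (infl k M)
  | defl_defl {G : Type} [Group G] [Finite G] (N M : Subgroup G) [N.Normal] [M.Normal]
      (h : N ≤ M) :
      Rel (defl k N ≫ defl k (M.map (QuotientGroup.mk' N)) ≫
          iso k (QuotientGroup.quotientQuotientEquivQuotient N M h))
        (defl k M)
  -- commutativity relations with isomorphisms
  | res_iso {G G' : Type} [Group G] [Finite G] [Group G'] [Finite G'] (K : Subgroup G)
      (f : G ≃* G') :
      Rel (res k K ≫ iso k (f.subgroupMap K)) (iso k f ≫ res k (K.map (f : G →* G')))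
  | ind_iso {G G' : Type} [Group G] [Finite G] [Group G'] [Finite G'] (K : Subgroup G)
      (f : G ≃* G') :
      Rel (ind k K ≫ iso k f) (iso k (f.subgroupMap K) ≫ ind k (K.map (f : G →* G')))
  | defl_iso {G G' : Type} [Group G] [Finite G] [Group G'] [Finite G'] (N : Subgroup G) [N.Normal]
      (f : G ≃* G') (N' : Subgroup G') [N'.Normal] (h : N.map (f : G →* G') = N') :
      Rel (defl k N ≫ iso k (QuotientGroup.congr N N' f h)) (iso k f ≫ defl k N')
  | infl_iso {G G' : Type} [Group G] [Finite G] [Group G'] [Finite G'] (N : Subgroup G) [N.Normal]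
      (f : G ≃* G') (N' : Subgroup G') [N'.Normal] (h : N.map (f : G →* G') = N') :
      Rel (infl k N ≫ iso k f) (iso k (QuotientGroup.congr N N' f h) ≫ infl k N')
  -- the Mackey formula, for any set `R` of representatives of the double cosets `H x K`
  | mackey {G : Type} [Group G] [Finite G] (H K : Subgroup G) (R : Finset G)
      (hR : ∀ g : G, ∃! x, x ∈ R ∧ g ∈ DoubleCoset.doubleCoset x (H : Set G) (K : Set G)) :
      Rel (ind k K ≫ res k H)
        (∑ x ∈ R, res k (conjInter H K x) ≫ iso k (conjIso H K x) ≫ ind k (interConj H K x))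
  -- inflation followed by deflation, for normal subgroups with trivial intersection
  | infl_defl {G : Type} [Group G] [Finite G] (M N : Subgroup G) [M.Normal] [N.Normal]
      (h : M ⊓ N = ⊥) :
      Rel (infl k M ≫ defl k N)
        (defl k ((M ⊔ N).map (QuotientGroup.mk' M)) ≫
          iso k ((QuotientGroup.quotientQuotientEquivQuotient M (M ⊔ N) le_sup_left).trans
            (QuotientGroup.quotientQuotientEquivQuotient N (M ⊔ N) le_sup_right).symm) ≫
          infl k ((M ⊔ N).map (QuotientGroup.mk' N)))
  | ind_defl {G : Type} [Group G] [Finite G] (H N : Subgroup G) [N.Normal] :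
      Rel (ind k H ≫ defl k N)
        (defl k (N.subgroupOf H) ≫ iso k (quotIso H N) ≫ ind k (imageMod H N))
  | infl_res {G : Type} [Group G] [Finite G] (H N : Subgroup G) [N.Normal] :
      Rel (infl k N ≫ res k H)
        (res k (imageMod H N) ≫ iso k (quotIso H N).symm ≫ infl k (N.subgroupOf H))
  | defl_res {G : Type} [Group G] [Finite G] (H N : Subgroup G) [N.Normal] (h : N ≤ H) :
      Rel (defl k N ≫ res k (imageMod H N))
        (res k H ≫ defl k (N.subgroupOf H) ≫ iso k (quotIso H N))
  | infl_ind {G : Type} [Group G] [Finite G] (H N : Subgroup G) [N.Normal] (h : N ≤ H) :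
      Rel (infl k (N.subgroupOf H) ≫ ind k H)
        (iso k (quotIso H N) ≫ ind k (imageMod H N) ≫ infl k N)

/-- The map of `SpanCat k` represented by a formal `k`-linear combination of strings of elementary
spans between two finite groups. -/
noncomputable def realizeMap {G H : FinGp} (a : freeObj k G ⟶ freeObj k H) : grp k G ⟶ grp k H :=
  (realize k).map a

/-- The formal elementary spans are sent to the classes of the elementary spans. -/
theorem realizeMap_gen {G H : FinGp} (e : Elem G H) :
    realizeMap k (gen k e) = KLin.ι k (PreSpan.cls e.span) :=
  (freeLift_map_embedding k (realizePath k) _).trans (Paths.lift_toPath _ _)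

/-- The `k`-linear categorical ideal generated by the relations. -/
noncomputable def relIdeal (X Y : FreeSpan k) : Submodule k (X ⟶ Y) :=
  Submodule.span k {u | ∃ (A B : FreeSpan k) (p : X ⟶ A) (a b : A ⟶ B) (q : B ⟶ Y),
    Rel k a b ∧ u = p ≫ (a - b) ≫ q}

theorem comp_mem_relIdeal {X Y Z : FreeSpan k} (p : X ⟶ Y) {u : Y ⟶ Z}
    (hu : u ∈ relIdeal k Y Z) : p ≫ u ∈ relIdeal k X Z := by
  induction hu using Submodule.span_induction with
  | mem u hu =>
    obtain ⟨A, B, p', a, b, q, h, rfl⟩ := hu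
    exact Submodule.subset_span ⟨A, B, p ≫ p', a, b, q, h, by simp only [Category.assoc]⟩
  | zero => rw [Limits.comp_zero]; exact Submodule.zero_mem _
  | add u v _ _ hu hv => rw [Preadditive.comp_add]; exact Submodule.add_mem _ hu hv
  | smul c u _ hu => rw [Linear.comp_smul]; exact Submodule.smul_mem _ c hu

theorem mem_relIdeal_comp {X Y Z : FreeSpan k} {u : X ⟶ Y} (q : Y ⟶ Z)
    (hu : u ∈ relIdeal k X Y) : u ≫ q ∈ relIdeal k X Z := by
  induction hu using Submodule.span_induction with
  | mem u hu =>
    obtain ⟨A, B, p, a, b, q', h, rfl⟩ := hu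
    exact Submodule.subset_span ⟨A, B, p, a, b, q' ≫ q, h, by simp only [Category.assoc]⟩
  | zero => rw [Limits.zero_comp]; exact Submodule.zero_mem _
  | add u v _ _ hu hv => rw [Preadditive.add_comp]; exact Submodule.add_mem _ hu hv
  | smul c u _ hu => rw [Linear.smul_comp]; exact Submodule.smul_mem _ c hu

/-- Congruence of morphisms modulo the ideal generated by the relations. -/
def relCongr : HomRel (FreeSpan k) := fun X Y f g => f - g ∈ relIdeal k X Y

instance relCongr_congruence : Congruence (relCongr k) where
  equivalence :=
    { refl := fun f => by
        change f - f ∈ _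
        rw [sub_self]; exact Submodule.zero_mem _
      symm := fun {f g} h => by
        change g - f ∈ _
        rw [← neg_sub]; exact Submodule.neg_mem _ h
      trans := fun {f g h} h₁ h₂ => by
        change f - h ∈ _
        rw [← sub_add_sub_cancel f g h]; exact Submodule.add_mem _ h₁ h₂ }
  comp_left {_ _ _} p {f g} h := by
    change p ≫ f - p ≫ g ∈ _
    rw [← Preadditive.comp_sub]; exact comp_mem_relIdeal k p h
  comp_right {_ _ _ f g} q h := by
    change f ≫ q - g ≫ q ∈ _
    rw [← Preadditive.sub_comp]; exact mem_relIdeal_comp k q h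

/-- The `k`-linear category presented by the elementary spans and the relations. -/
abbrev Presented := CategoryTheory.Quotient (relCongr k)

theorem relCongr_add ⦃X Y : FreeSpan k⦄ (f₁ f₂ g₁ g₂ : X ⟶ Y) (h : relCongr k f₁ f₂)
    (h' : relCongr k g₁ g₂) : relCongr k (f₁ + g₁) (f₂ + g₂) := by
  change f₁ + g₁ - (f₂ + g₂) ∈ _
  rw [add_sub_add_comm]
  exact Submodule.add_mem _ h h'

noncomputable instance presentedPreadditive : Preadditive (Presented k) :=
  CategoryTheory.Quotient.preadditive (relCongr k) (relCongr_add k)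

instance presented_functor_additive : (CategoryTheory.Quotient.functor (relCongr k)).Additive :=
  CategoryTheory.Quotient.functor_additive (relCongr k) (relCongr_add k)

noncomputable instance presentedLinear : Linear k (Presented k) :=
  CategoryTheory.Quotient.linear k (relCongr k) (fun a X Y f g h => by
    change a • f - a • g ∈ _
    rw [← smul_sub]
    exact Submodule.smul_mem _ a h)

/-- The relations hold in `SpanCat k`. -/
def RelationsHold : Prop :=
  ∀ ⦃X Y : FreeSpan k⦄ (a b : X ⟶ Y), Rel k a b → (realize k).map a = (realize k).map b

theorem realize_eq_of_relCongr (h : RelationsHold k) (X Y : FreeSpan k) (f g : X ⟶ Y)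
    (hfg : relCongr k f g) : (realize k).map f = (realize k).map g := by
  rw [← sub_eq_zero, ← Functor.map_sub]
  change f - g ∈ relIdeal k X Y at hfg
  generalize f - g = u at hfg ⊢
  induction hfg using Submodule.span_induction with
  | mem u hu =>
    obtain ⟨A, B, p, a, b, q, hab, rfl⟩ := hu
    rw [Functor.map_comp, Functor.map_comp, Functor.map_sub, h a b hab, sub_self,
      Limits.zero_comp, Limits.comp_zero]
  | zero => exact Functor.map_zero _ _ _
  | add u v _ _ hu hv => rw [Functor.map_add, hu, hv, add_zero]
  | smul c u _ hu => rw [Functor.map_smul, hu, smul_zero]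

/-- The functor from the presented category to `SpanCat k`, if the relations hold there. -/
noncomputable def comparison (h : RelationsHold k) : Presented k ⥤ SpanCat k :=
  CategoryTheory.Quotient.lift _ (realize k) (realize_eq_of_relCongr k h)

instance comparison_additive (h : RelationsHold k) : (comparison k h).Additive where
  map_add {X Y} f g := by
    obtain ⟨f, rfl⟩ := (CategoryTheory.Quotient.functor (relCongr k)).map_surjective f
    obtain ⟨g, rfl⟩ := (CategoryTheory.Quotient.functor (relCongr k)).map_surjective g
    rw [← Functor.map_add]
    exact (realize k).map_add

instance comparison_linear (h : RelationsHold k) : (comparison k h).Linear k where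
  map_smul {X Y} f a := by
    obtain ⟨f, rfl⟩ := (CategoryTheory.Quotient.functor (relCongr k)).map_surjective f
    rw [← Functor.map_smul]
    exact (realize k).map_smul _ _

end Presentation

end SpanPres

/-! The middle groupoid of a span between finite groups `G` and `H` splits into components. Each
component amounts to a finite group `P` with homomorphisms `u : P → G` and `v : P → H`, well defined
up to isomorphism of `P` and conjugation in `G` and `H`. Its class is the contravariant span of `u`
followed by the covariant span of `v`. A homomorphism is a quotient map, an isomorphism and an
inclusion in turn, so the elementary spans generate (`exists_realizes`).

That the relations suffice is shown by constructing an inverse. In the presented category, `push u`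
is defined as deflation to the quotient by the kernel, isomorphism, induction from the range. The
relations of transitivity, compatibility with isomorphisms and deflation past induction make `push`
functorial (`PushSystem.push_comp`). The same argument in the opposite category makes `pull`
functorial, which is why the argument is carried out for an abstract `PushSystem`. Sending a span to
the sum of `pull u ≫ push v` over its components is well defined, because inner automorphisms act
trivially. This is `eval`.

The crux is that `eval` respects composition. By functoriality of `push` and `pull` this reduces to
base change: `push b ≫ pull u` must equal the value of the iso-comma span of `b` and `u`, which is a
sum over double cosets. Pasting squares reduces to `b` and `u` each injective or surjective, and the
four cases are exactly the four relations that mix the two variances: the Mackey formula,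
restriction after deflation, induction after inflation, and deflation after inflation when the
kernels meet trivially (`baseChange`). On elementary spans `eval` gives back the generator, so it is
a left inverse to realization modulo the relations, and realization is injective there
(`realizeMap_eq_iff`).

The relations hold in the span category by the same pullback squares (`psh_pll_eq_sum`,
`relationsHold`). Disjoint unions are biproducts, every groupoid is the sum of the automorphism
groups of its components, and so the statements extend to matrices and to the additive hull. -/

namespace SpanPres

universe u v w

/-! ### Covariant and contravariant spans of functors -/

section Functors

variable {X Y Z W : FinGpd}

theorem PreSpan.cls_eq_iff {S T : PreSpan X Y} : S.cls = T.cls ↔ PreSpan.Equiv S T :=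
  Quotient.eq (r := PreSpan.setoid X Y)

theorem PreSpan.cls_add (S T : PreSpan X Y) : S.cls + T.cls = (PreSpan.add S T).cls := rfl

theorem PreSpan.exists_cls (s : X ⟶ Y) : ∃ S : PreSpan X Y, s = S.cls := by
  obtain ⟨S⟩ := s; exact ⟨S, rfl⟩

/-- The covariant span of a functor. -/
def pushF (F : X ⥤ Y) : X ⟶ Y := PreSpan.cls ⟨X, 𝟭 X, F⟩

/-- The contravariant span of a functor. -/
def pullF (F : X ⥤ Y) : Y ⟶ X := PreSpan.cls ⟨X, F, 𝟭 X⟩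

/-- An iso-comma groupoid over an identity leg projects to the other factor by an equivalence,
because the second object is determined up to the isomorphism stored in `P.hom`. That same
isomorphism compares the legs. -/
theorem cls_comp_pushF (S : PreSpan X Y) (G : Y ⥤ Z) :
    S.cls ≫ pushF G = PreSpan.cls ⟨S.mid, S.l, S.r ⋙ G⟩ := by
  refine PreSpan.cls_eq_iff.2 ⟨Comma.fst S.r (𝟭 Y), ?_, ⟨Iso.refl _⟩, ⟨?_⟩⟩
  · exact
      { faithful := ⟨fun {P Q} f g h => by
          have h' : f.left = g.left := h
          refine Comma.hom_ext _ _ h' ?_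
          have h1 := f.w
          have h2 := g.w
          rw [h'] at h1
          rw [h1] at h2
          exact (cancel_epi P.hom).1 h2⟩
        full := ⟨fun {P Q} f =>
          ⟨{ left := f, right := inv P.hom ≫ S.r.map f ≫ Q.hom, w := by simp }, rfl⟩⟩
        essSurj := ⟨fun y => ⟨⟨y, S.r.obj y, 𝟙 _⟩, ⟨Iso.refl _⟩⟩⟩ }
  · have e : Comma.fst S.r (𝟭 Y) ⋙ S.r ≅ Comma.snd S.r (𝟭 Y) :=
      NatIso.ofComponents (fun P => asIso P.hom) (fun {P Q} f => CommaMorphism.w (X := P) (Y := Q) f)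
    exact Functor.isoWhiskerRight e.symm G

theorem pullF_comp_cls (F : Y ⥤ X) (T : PreSpan Y Z) :
    pullF F ≫ T.cls = PreSpan.cls ⟨T.mid, T.l ⋙ F, T.r⟩ := by
  refine PreSpan.cls_eq_iff.2 ⟨Comma.snd (𝟭 Y) T.l, ?_, ⟨?_⟩, ⟨Iso.refl _⟩⟩
  · exact
      { faithful := ⟨fun {P Q} f g h => by
          have h' : f.right = g.right := h
          refine Comma.hom_ext _ _ ?_ h'
          have h1 := f.w
          have h2 := g.w
          rw [h'] at h1
          rw [← h2] at h1
          exact (cancel_mono Q.hom).1 h1⟩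
        full := ⟨fun {P Q} f =>
          ⟨{ left := P.hom ≫ T.l.map f ≫ inv Q.hom, right := f, w := by simp }, rfl⟩⟩
        essSurj := ⟨fun y => ⟨⟨T.l.obj y, y, 𝟙 _⟩, ⟨Iso.refl _⟩⟩⟩ }
  · have e : Comma.fst (𝟭 Y) T.l ≅ Comma.snd (𝟭 Y) T.l ⋙ T.l :=
      NatIso.ofComponents (fun P => asIso P.hom) (fun {P Q} f => CommaMorphism.w (X := P) (Y := Q) f)
    exact Functor.isoWhiskerRight e F

theorem pushF_comp (F : X ⥤ Y) (G : Y ⥤ Z) : pushF F ≫ pushF G = pushF (F ⋙ G) :=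
  cls_comp_pushF _ G

theorem pullF_comp (F : X ⥤ Y) (G : Y ⥤ Z) : pullF G ≫ pullF F = pullF (F ⋙ G) :=
  pullF_comp_cls G _

theorem pullF_pushF (F : Z ⥤ X) (G : Z ⥤ Y) :
    pullF F ≫ pushF G = PreSpan.cls ⟨Z, F, G⟩ :=
  cls_comp_pushF _ G

theorem pushF_congr {F G : X ⥤ Y} (e : F ≅ G) : pushF F = pushF G :=
  PreSpan.cls_eq_iff.2 ⟨𝟭 _, inferInstance, ⟨Iso.refl _⟩, ⟨e⟩⟩

theorem pushF_eq_pullF (F : X ⥤ Y) (G : Y ⥤ X) [G.IsEquivalence] (e : G ⋙ F ≅ 𝟭 Y) :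
    pushF F = pullF G :=
  PreSpan.cls_eq_iff.2 (PreSpan.Equiv.symm ⟨G, inferInstance, ⟨Iso.refl _⟩, ⟨e.symm⟩⟩)

/-- A fully faithful functor induces a split monomorphism of spans. -/
theorem pushF_pullF_self (F : X ⥤ Y) [F.Full] [F.Faithful] : pushF F ≫ pullF F = 𝟙 X := by
  -- For fully faithful `F` the diagonal into the iso-comma groupoid of `F` with itself is an
  -- equivalence.
  refine PreSpan.cls_eq_iff.2 (PreSpan.Equiv.symm
    ⟨{ obj := fun x => ⟨x, x, 𝟙 _⟩
       map := fun f => { left := f, right := f, w := by simp } },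
      { faithful := ⟨fun {_ _} _ _ h => congrArg CommaMorphism.left h⟩
        full := ⟨fun {P Q} f => ⟨f.left, Comma.hom_ext _ _ rfl (F.map_injective ?_)⟩⟩
        essSurj := ⟨fun P => ⟨P.left, ⟨Groupoid.isoEquivHom _ _ |>.symm
          { left := 𝟙 _, right := F.preimage P.hom, w := by simp }⟩⟩⟩ },
      ⟨Iso.refl _⟩, ⟨Iso.refl _⟩⟩)
  simpa using f.w

/-- Functors with disjoint essential images are orthogonal. -/
theorem pushF_pullF_of_disjoint (F : X ⥤ Z) (G : Y ⥤ Z)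
    (h : ∀ x y, (F.obj x ⟶ G.obj y) → False) : pushF F ≫ pullF G = 0 :=
  PreSpan.cls_eq_iff.2 (PreSpan.equiv_of_isEmpty _ _ (fun P => h _ _ P.hom) (fun P => P.as.elim))

end Functors

/-! ### Splitting a span along its middle groupoid -/

section Decomposition

variable {X Y : FinGpd}

instance (A B : FinGpd) : (CategoryTheory.Sum.inl_ A B).Full := ⟨fun {_ _} f => ⟨f.down, rfl⟩⟩

instance (A B : FinGpd) : (CategoryTheory.Sum.inl_ A B).Faithful :=
  ⟨fun {_ _} _ _ h => congrArg ULift.down h⟩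

instance (A B : FinGpd) : (CategoryTheory.Sum.inr_ A B).Full := ⟨fun {_ _} f => ⟨f.down, rfl⟩⟩

instance (A B : FinGpd) : (CategoryTheory.Sum.inr_ A B).Faithful :=
  ⟨fun {_ _} _ _ h => congrArg ULift.down h⟩

theorem PreSpan.cls_eq_add (S : PreSpan X Y) {A B : FinGpd} (F : A ⥤ S.mid) (G : B ⥤ S.mid)
    [F.Full] [F.Faithful] [G.Full] [G.Faithful]
    (disj : ∀ a b, (F.obj a ⟶ G.obj b) → False)
    (cover : ∀ s, (∃ a, Nonempty (F.obj a ⟶ s)) ∨ ∃ b, Nonempty (G.obj b ⟶ s)) :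
    S.cls = PreSpan.cls ⟨A, F ⋙ S.l, F ⋙ S.r⟩ + PreSpan.cls ⟨B, G ⋙ S.l, G ⋙ S.r⟩ := by
  rw [PreSpan.cls_add]
  symm
  refine PreSpan.cls_eq_iff.2 ⟨F.sum' G, ?_, ⟨?_⟩, ⟨?_⟩⟩
  rotate_left
  · exact Functor.sumIsoExt (Iso.refl _) (Iso.refl _)
  · exact Functor.sumIsoExt (Iso.refl _) (Iso.refl _)
  exact
    { faithful := ⟨fun {P Q} f g h => by
        rcases P with P | P <;> rcases Q with Q | Q
        · exact congrArg ULift.up (F.map_injective h)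
        · exact f.elim
        · exact f.elim
        · exact congrArg ULift.up (G.map_injective h)⟩
      full := ⟨fun {P Q} f => by
        rcases P with P | P <;> rcases Q with Q | Q
        · exact ⟨ULift.up (F.preimage f), F.map_preimage f⟩
        · exact (disj _ _ f).elim
        · exact (disj Q P (Groupoid.inv (obj := S.mid) f)).elim
        · exact ⟨ULift.up (G.preimage f), G.map_preimage f⟩⟩
      essSurj := ⟨fun s => by
        rcases cover s with ⟨a, ⟨f⟩⟩ | ⟨b, ⟨f⟩⟩
        · exact ⟨.inl a, ⟨(Groupoid.isoEquivHom _ _).symm f⟩⟩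
        · exact ⟨.inr b, ⟨(Groupoid.isoEquivHom _ _).symm f⟩⟩⟩ }

/-- The full subgroupoid on a set of objects. -/
def FinGpd.restrict (A : FinGpd) (P : A → Prop) : FinGpd where
  carrier := InducedCategory A (Subtype.val : {a // P a} → A)
  finite_obj := inferInstanceAs (Finite {a // P a})
  finite_hom x y := Finite.of_injective (fun f : x ⟶ y => f.hom) fun _ _ h =>
    InducedCategory.hom_ext h

/-- The inclusion of the full subgroupoid on a set of objects. -/
def FinGpd.incl (A : FinGpd) (P : A → Prop) : A.restrict P ⥤ A :=
  inducedFunctor (Subtype.val : {a // P a} → A)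

instance (A : FinGpd) (P : A → Prop) : (A.incl P).Full :=
  inferInstanceAs (inducedFunctor (Subtype.val : {a // P a} → A)).Full

instance (A : FinGpd) (P : A → Prop) : (A.incl P).Faithful :=
  inferInstanceAs (inducedFunctor (Subtype.val : {a // P a} → A)).Faithful

/-- A span is the sum of its restrictions along a family of fully faithful functors with disjoint
essential images which jointly cover the middle groupoid. -/
theorem PreSpan.cls_eq_sum (S : PreSpan X Y) {J : Type*} [Fintype J] (Q : J → FinGpd)
    (F : ∀ j, Q j ⥤ S.mid) (full : ∀ j, (F j).Full) (faithful : ∀ j, (F j).Faithful)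
    (disj : ∀ i j, i ≠ j → ∀ a b, ((F i).obj a ⟶ (F j).obj b) → False)
    (cover : ∀ s, ∃ j a, Nonempty ((F j).obj a ⟶ s)) :
    S.cls = ∑ j, PreSpan.cls ⟨Q j, F j ⋙ S.l, F j ⋙ S.r⟩ := by
  classical
  revert S Q
  refine Fintype.induction_empty_option (P := fun J _ => ∀ (S : PreSpan X Y) (Q : J → FinGpd)
    (F : ∀ j, Q j ⥤ S.mid) (_ : ∀ j, (F j).Full) (_ : ∀ j, (F j).Faithful)
    (_ : ∀ i j, i ≠ j → ∀ a b, ((F i).obj a ⟶ (F j).obj b) → False)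
    (_ : ∀ s, ∃ j a, Nonempty ((F j).obj a ⟶ s)),
    S.cls = ∑ j, PreSpan.cls ⟨Q j, F j ⋙ S.l, F j ⋙ S.r⟩) ?_ ?_ ?_ J
  · intro α β _ e ih S Q F full faithful disj cover
    let _ := Fintype.ofEquiv β e.symm
    rw [ih S (fun a => Q (e a)) (fun a => F (e a)) (fun _ => full _) (fun _ => faithful _)
      (fun i j h => disj _ _ (e.injective.ne h))
      (fun s => by
        obtain ⟨j, a, h⟩ := cover s
        obtain ⟨j, rfl⟩ := e.surjective j
        exact ⟨j, a, h⟩)]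
    exact Fintype.sum_equiv e _ _ (fun _ => rfl)
  · intro S Q F full faithful disj cover
    rw [Finset.univ_eq_empty, Finset.sum_empty]
    exact PreSpan.cls_eq_iff.2 (PreSpan.equiv_of_isEmpty _ _ (fun s => by
      obtain ⟨j, -⟩ := cover s; exact j.elim) (fun s => s.as.elim))
  · intro α _ ih S Q F full faithful disj cover
    -- `B` is the union of the essential images of the functors other than `F none`. The span splits
    -- into `F none` and `B`, and the induction hypothesis applies to its restriction to `B`.
    let B := S.mid.restrict (fun s => ∃ j a, Nonempty ((F (some j)).obj a ⟶ s))
    let I : B ⥤ S.mid := S.mid.incl _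
    let F' : ∀ j, Q (some j) ⥤ B := fun j =>
      { obj := fun a => ⟨(F (some j)).obj a, j, a, ⟨𝟙 _⟩⟩
        map := fun f => ⟨(F (some j)).map f⟩
        map_id := fun a => InducedCategory.hom_ext ((F (some j)).map_id a)
        map_comp := fun f g => InducedCategory.hom_ext ((F (some j)).map_comp f g) }
    have := full none
    have := faithful none
    rw [Fintype.sum_option, S.cls_eq_add (F none) I]
    · congr 1
      refine ih ⟨B, I ⋙ S.l, I ⋙ S.r⟩ (fun j => Q (some j)) F'
        (fun j => ⟨fun {a b} f => ?_⟩) (fun j => ⟨fun {a b} f g h => ?_⟩) ?_ ?_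
      · obtain ⟨g, hg⟩ := (full (some j)).map_surjective f.hom
        exact ⟨g, InducedCategory.hom_ext hg⟩
      · exact (faithful (some j)).map_injective (congrArg I.map h)
      · intro i j h a b f
        exact disj _ _ (fun e => h (Option.some_injective _ e)) a b f.hom
      · rintro ⟨s, j, a, ⟨f⟩⟩
        exact ⟨j, a, ⟨⟨f⟩⟩⟩
    · rintro a ⟨s, j, b, ⟨f⟩⟩ g
      exact disj none (some j) (by simp) a b (g ≫ Groupoid.inv f)
    · intro s
      obtain ⟨j, a, ⟨f⟩⟩ := cover s
      cases j with
      | none => exact .inl ⟨a, ⟨f⟩⟩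
      | some j => exact .inr ⟨⟨s, j, a, ⟨f⟩⟩, ⟨𝟙 _⟩⟩

end Decomposition

/-! ### Spans of group homomorphisms and double cosets -/

section GroupSpans

variable {G H L P : Type} [Group G] [Finite G] [Group H] [Finite H] [Group L] [Finite L]
  [Group P] [Finite P]

/-- The covariant span of a homomorphism of finite groups. -/
def psh (u : H →* G) : (FinGp.of H).toGpd ⟶ (FinGp.of G).toGpd := (pushSpan u).cls

/-- The contravariant span of a homomorphism of finite groups. -/
def pll (u : H →* G) : (FinGp.of G).toGpd ⟶ (FinGp.of H).toGpd := (pullSpan u).cls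

theorem psh_comp (u : G →* H) (v : H →* L) : psh u ≫ psh v = psh (v.comp u) :=
  pushF_comp (X := (FinGp.of G).toGpd) (Y := (FinGp.of H).toGpd) (Z := (FinGp.of L).toGpd)
    u.toFunctor v.toFunctor

theorem pll_comp (u : G →* H) (v : H →* L) : pll v ≫ pll u = pll (v.comp u) :=
  pullF_comp (X := (FinGp.of G).toGpd) (Y := (FinGp.of H).toGpd) (Z := (FinGp.of L).toGpd)
    u.toFunctor v.toFunctor

theorem pll_psh (u : P →* G) (v : P →* H) : pll u ≫ psh v =
    PreSpan.cls ⟨(FinGp.of P).toGpd, u.toFunctor, v.toFunctor⟩ :=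
  pullF_pushF (Z := (FinGp.of P).toGpd) (X := (FinGp.of G).toGpd) (Y := (FinGp.of H).toGpd)
    u.toFunctor v.toFunctor

theorem psh_id : psh (MonoidHom.id G) = 𝟙 (FinGp.of G).toGpd := rfl

theorem pll_id : pll (MonoidHom.id G) = 𝟙 (FinGp.of G).toGpd := rfl

/-- Conjugate homomorphisms induce isomorphic functors. -/
def conjNatIso (u v : H →* G) (x : G) (h : ∀ a, v a = x * u a * x⁻¹) :
    u.toFunctor ≅ v.toFunctor :=
  NatIso.ofComponents (fun _ => (Groupoid.isoEquivHom _ _).symm x) (fun {_ _} f => by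
    -- Composition `f ≫ g` in `SingleObj` is the product `g * f`.
    change x * u f = v f * x
    rw [h, inv_mul_cancel_right])

theorem psh_congr (u v : H →* G) (x : G) (h : ∀ a, v a = x * u a * x⁻¹) : psh u = psh v :=
  pushF_congr (X := (FinGp.of H).toGpd) (Y := (FinGp.of G).toGpd) (conjNatIso u v x h)

/-- The middle group may be replaced along `f`, which moves the isomorphism to the other leg.
Isomorphisms can therefore be read contravariantly when they are combined with restrictions and
inflations. -/
theorem psh_equiv (f : G ≃* H) : psh f.toMonoidHom = pll f.symm.toMonoidHom := by
  have hf : (f.symm.toMonoidHom.toFunctor : SingleObj H ⥤ SingleObj G).IsEquivalence :=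
    inferInstanceAs f.symm.toSingleObjEquiv.functor.IsEquivalence
  exact pushF_eq_pullF (X := (FinGp.of G).toGpd) (Y := (FinGp.of H).toGpd)
    f.toMonoidHom.toFunctor f.symm.toMonoidHom.toFunctor f.toSingleObjEquiv.counitIso

theorem psh_symm_equiv (f : G ≃* H) : psh f.symm.toMonoidHom = pll f.toMonoidHom :=
  psh_equiv f.symm

/-- Base change: the iso-comma groupoid of two homomorphisms `b : P → G` and `u : L → G` decomposes
along a family of commutative squares indexed by representatives of double cosets. -/
theorem psh_pll_eq_sum (b : P →* G) (u : L →* G) {J : Type*} [Fintype J] (x : J → G)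
    (Q : J → Type) [∀ j, Group (Q j)] [∀ j, Finite (Q j)] (c : ∀ j, Q j →* P) (d : ∀ j, Q j →* L)
    (comm : ∀ j q, x j * b (c j q) = u (d j q) * x j)
    (inj : ∀ j q, c j q = 1 → d j q = 1 → q = 1)
    (surj : ∀ j p l, x j * b p = u l * x j → ∃ q, c j q = p ∧ d j q = l)
    (cover : ∀ g, ∃ j p l, g = u l * x j * b p)
    (disj : ∀ i j p l, x i = u l * x j * b p → i = j) :
    psh b ≫ pll u = ∑ j, pll (c j) ≫ psh (d j) := by
  -- An object of the iso-comma groupoid is an element of `G`, and its isomorphism class is a double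
  -- coset of `u(L)` and `b(P)`. The automorphisms of `x j` are the pairs `(p, l)` with `x j * b p =
  -- u l * x j`, and `comm`, `inj`, `surj` identify them with `Q j`.
  let F : ∀ j, SingleObj (Q j) ⥤ Comma b.toFunctor u.toFunctor := fun j =>
    { obj := fun _ => ⟨SingleObj.star P, SingleObj.star L, x j⟩
      map := fun q => { left := c j q, right := d j q, w := comm j q }
      map_id := fun _ => Comma.hom_ext _ _ (map_one (c j)) (map_one (d j))
      map_comp := fun q r => Comma.hom_ext _ _ (map_mul (c j) r q) (map_mul (d j) r q) }
  simp only [pll_psh]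
  refine PreSpan.cls_eq_sum (PreSpan.comp (pushSpan b) (pullSpan u))
    (fun j => (FinGp.of (Q j)).toGpd) F (fun j => ⟨fun {_ _} f => ?_⟩)
    (fun j => ⟨fun {_ _} q r h => ?_⟩) ?_ ?_
  · obtain ⟨q, hc, hd⟩ := surj j f.left f.right f.w
    exact ⟨q, Comma.hom_ext _ _ hc hd⟩
  · have h1 : c j q = c j r := congrArg CommaMorphism.left h
    have h2 : d j q = d j r := congrArg CommaMorphism.right h
    have := inj j (q⁻¹ * r) ((map_mul _ _ _).trans (by rw [map_inv, h1, inv_mul_cancel]))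
      ((map_mul _ _ _).trans (by rw [map_inv, h2, inv_mul_cancel]))
    exact inv_mul_eq_one.1 this
  · intro i j hij _ _ f
    refine hij (disj i j (f.left : P) ((f.right : L)⁻¹) ?_)
    have hw : x j * b f.left = u f.right * x i := f.w
    rw [mul_assoc, hw, map_inv, inv_mul_cancel_left]
  · intro s
    obtain ⟨j, p, l, h⟩ := cover s.hom
    refine ⟨j, SingleObj.star (Q j), ⟨{ left := (p⁻¹ : P), right := l, w := ?_ }⟩⟩
    change (s.hom : G) * b p⁻¹ = u l * x j
    rw [h, map_inv, mul_inv_cancel_right]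

/-- Base change along a pullback square of groups with `G = u(L) b(P)`. -/
theorem psh_pll_eq (b : P →* G) (u : L →* G) {Q : Type} [Group Q] [Finite Q] (c : Q →* P)
    (d : Q →* L) (comm : ∀ q, b (c q) = u (d q)) (inj : ∀ q, c q = 1 → d q = 1 → q = 1)
    (surj : ∀ p l, b p = u l → ∃ q, c q = p ∧ d q = l) (cover : ∀ g, ∃ p l, g = u l * b p) :
    psh b ≫ pll u = pll c ≫ psh d := by
  rw [psh_pll_eq_sum b u (J := Unit) (fun _ => 1) (fun _ => Q) (fun _ => c) (fun _ => d)
    (fun _ q => by rw [one_mul, mul_one, comm]) (fun _ => inj)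
    (fun _ p l h => surj p l (by simpa using h))
    (fun g => by obtain ⟨p, l, h⟩ := cover g; exact ⟨(), p, l, by simpa using h⟩)
    (fun _ _ _ _ _ => rfl)]
  exact Fintype.sum_unique _

end GroupSpans

/-! ### The relations hold in the category of spans -/

section Relations

variable (k : Type w) [CommRing k]

/-- The canonical map to the linearization, as an additive map. -/
def ιHom {C : Type*} [Category C] [AddMonEnriched C] (X Y : C) :
    (X ⟶ Y) →+ ((⟨X⟩ : KLin k C) ⟶ ⟨Y⟩) where
  toFun f := KLin.ι k f
  map_zero' := by
    change TensorProduct.tmul ℤ (1 : k) _ = _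
    rw [map_zero]; exact TensorProduct.tmul_zero _ _
  map_add' f g := by
    change TensorProduct.tmul ℤ (1 : k) _ = _
    rw [map_add]; exact TensorProduct.tmul_add _ _ _

theorem ιHom_comp {C : Type*} [Category C] [AddMonEnriched C] {X Y Z : C}
    (f : X ⟶ Y) (g : Y ⟶ Z) : ιHom k X Y f ≫ ιHom k Y Z g = ιHom k X Z (f ≫ g) :=
  KLin.compLin_ι k f g

theorem ιHom_id {C : Type*} [Category C] [AddMonEnriched C] (X : C) :
    ιHom k X X (𝟙 X) = 𝟙 (⟨X⟩ : KLin k C) := rfl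

/-- The formal combination `a` of strings of elementary spans represents the class of spans `s`. -/
def Realizes {G H : FinGp} (a : freeObj k G ⟶ freeObj k H) (s : G.toGpd ⟶ H.toGpd) : Prop :=
  realizeMap k a = ιHom k _ _ s

variable {k}

theorem Realizes.comp {G H L : FinGp} {a : freeObj k G ⟶ freeObj k H}
    {b : freeObj k H ⟶ freeObj k L} {s : G.toGpd ⟶ H.toGpd} {t : H.toGpd ⟶ L.toGpd}
    (h : Realizes k a s) (h' : Realizes k b t) : Realizes k (a ≫ b) (s ≫ t) :=
  ((realize k).map_comp a b).trans ((congrArg₂ (fun u v => u ≫ v) h h').trans (ιHom_comp k s t))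

theorem Realizes.sum {G H : FinGp} {J : Type*} (R : Finset J)
    {a : J → (freeObj k G ⟶ freeObj k H)} {s : J → (G.toGpd ⟶ H.toGpd)}
    (h : ∀ j, Realizes k (a j) (s j)) : Realizes k (∑ j ∈ R, a j) (∑ j ∈ R, s j) :=
  ((realize k).map_sum a R).trans ((Finset.sum_congr rfl fun j _ => h j).trans
    (map_sum (ιHom k _ _) s R).symm)

theorem Realizes.map_eq {G H : FinGp} {a b : freeObj k G ⟶ freeObj k H} {s t : G.toGpd ⟶ H.toGpd}
    (h : Realizes k a s) (h' : Realizes k b t) (e : s = t) :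
    (realize k).map a = (realize k).map b :=
  h.trans ((congrArg _ e).trans h'.symm)

theorem Realizes.congr {G H : FinGp} {a : freeObj k G ⟶ freeObj k H} {s t : G.toGpd ⟶ H.toGpd}
    (h : Realizes k a s) (e : s = t) : Realizes k a t := e ▸ h

theorem Realizes.id (G : FinGp) : Realizes k (𝟙 (freeObj k G)) (𝟙 G.toGpd) :=
  (realize k).map_id _

section
variable {G G' : Type} [Group G] [Finite G] [Group G'] [Finite G']

theorem realizes_res (H : Subgroup G) : Realizes k (res k H) (pll H.subtype) :=
  realizeMap_gen k _

theorem realizes_ind (H : Subgroup G) : Realizes k (ind k H) (psh H.subtype) :=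
  realizeMap_gen k _

theorem realizes_infl (N : Subgroup G) [N.Normal] :
    Realizes k (infl k N) (pll (QuotientGroup.mk' N)) :=
  realizeMap_gen k _

theorem realizes_defl (N : Subgroup G) [N.Normal] :
    Realizes k (defl k N) (psh (QuotientGroup.mk' N)) :=
  realizeMap_gen k _

theorem realizes_iso (f : G ≃* G') : Realizes k (iso k f) (psh f.toMonoidHom) :=
  realizeMap_gen k _

theorem realizes_iso' (f : G ≃* G') : Realizes k (iso k f) (pll f.symm.toMonoidHom) :=
  (realizeMap_gen k _).trans (congrArg _ (psh_equiv f))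

end

section QuotientIsomorphisms

variable {G : Type} [Group G]

/-- The canonical isomorphism `(G/M)/(MN/M) ≃* (G/N)/(MN/N)`. -/
abbrev quotSupIso (M N : Subgroup G) [M.Normal] [N.Normal] :
    (G ⧸ M) ⧸ (M ⊔ N).map (QuotientGroup.mk' M) ≃* (G ⧸ N) ⧸ (M ⊔ N).map (QuotientGroup.mk' N) :=
  (QuotientGroup.quotientQuotientEquivQuotient M (M ⊔ N) le_sup_left).trans
    (QuotientGroup.quotientQuotientEquivQuotient N (M ⊔ N) le_sup_right).symm

theorem quotSupIso_mk (M N : Subgroup G) [M.Normal] [N.Normal] (g : G) :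
    quotSupIso M N (QuotientGroup.mk' _ (QuotientGroup.mk' M g)) =
      QuotientGroup.mk' _ (QuotientGroup.mk' N g) := by
  rw [MulEquiv.trans_apply, MulEquiv.symm_apply_eq]
  rfl

theorem quotIso_symm_mk (H N : Subgroup G) [N.Normal] :
    (quotIso H N).symm.toMonoidHom.comp ((QuotientGroup.mk' N).subgroupMap H) =
      QuotientGroup.mk' _ := by
  ext x
  exact (quotIso H N).symm_apply_apply (QuotientGroup.mk' _ x)

/-- Every subgroup of a quotient group is the image of a subgroup containing the kernel. -/
theorem exists_eq_imageMod (N : Subgroup G) [N.Normal] (I : Subgroup (G ⧸ N)) :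
    ∃ H : Subgroup G, N ≤ H ∧ imageMod H N = I := by
  refine ⟨I.comap (QuotientGroup.mk' N), fun x hx => ?_,
    Subgroup.map_comap_eq_self_of_surjective (QuotientGroup.mk'_surjective N) I⟩
  have h1 : QuotientGroup.mk' N x = 1 := (QuotientGroup.eq_one_iff x).2 hx
  rw [Subgroup.mem_comap, h1]
  exact I.one_mem

end QuotientIsomorphisms

section SpanIdentities

variable {G G' : Type} [Group G] [Finite G] [Group G'] [Finite G']

/-- The automorphisms of `x` in the iso-comma groupoid are pairs `(p, h)` in `K × H` with `x p = h
x`. Such a pair is determined by `p`, which runs through `Hˣ ∩ K`. -/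
theorem psh_pll_mackey (H K : Subgroup G) (R : Finset G)
    (hR : ∀ g : G, ∃! x, x ∈ R ∧ g ∈ DoubleCoset.doubleCoset x (H : Set G) (K : Set G)) :
    psh K.subtype ≫ pll H.subtype = ∑ x ∈ R, pll (conjInter H K x).subtype ≫
      psh (conjIso H K x).toMonoidHom ≫ psh (interConj H K x).subtype := by
  rw [← Finset.sum_coe_sort]
  simp only [psh_comp]
  refine psh_pll_eq_sum K.subtype H.subtype (J := R) (fun x => (x : G))
    (fun x => conjInter H K x) (fun x => (conjInter H K x).subtype)
    (fun x => (interConj H K x).subtype.comp (conjIso H K x).toMonoidHom) ?_ ?_ ?_ ?_ ?_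
  · intro x q
    change (x : G) * q.1.1 = x * q.1.1 * (x : G)⁻¹ * x
    group
  · intro x q h _
    exact Subtype.ext h
  · intro x p l h
    have h' : (x : G) * p.1 * (x : G)⁻¹ = l := by
      rw [mul_inv_eq_iff_eq_mul]; exact h
    refine ⟨⟨p, Subgroup.mem_subgroupOf.2 ⟨l, l.2, ?_⟩⟩, rfl, Subtype.ext h'⟩
    simp [← h', mul_assoc]
  · intro g
    obtain ⟨x, ⟨hx, hg⟩, -⟩ := hR g
    obtain ⟨h, hh, k, hk, e⟩ := DoubleCoset.mem_doubleCoset.1 hg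
    exact ⟨⟨x, hx⟩, ⟨k, hk⟩, ⟨h, hh⟩, e⟩
  · intro x y p l h
    obtain ⟨z, -, hz⟩ := hR x
    refine Subtype.ext ((hz x ⟨x.2, DoubleCoset.mem_doubleCoset.2
      ⟨1, H.one_mem, 1, K.one_mem, by simp⟩⟩).trans (hz y ⟨y.2, DoubleCoset.mem_doubleCoset.2
      ⟨l, l.2, p, p.2, h⟩⟩).symm)

/-- Read from right to left this is base change: since `M ∩ N = 1`, the group `G` is the pullback of
`G/M` and `G/N` over `G/MN`. The maps to `G/MN` are onto, so there is a single double coset. -/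
theorem pll_psh_quotient (M N : Subgroup G) [M.Normal] [N.Normal] (h : M ⊓ N = ⊥) :
    pll (QuotientGroup.mk' M) ≫ psh (QuotientGroup.mk' N) =
      psh ((quotSupIso M N).toMonoidHom.comp
        (QuotientGroup.mk' ((M ⊔ N).map (QuotientGroup.mk' M)))) ≫
      pll (QuotientGroup.mk' ((M ⊔ N).map (QuotientGroup.mk' N))) := by
  symm
  refine psh_pll_eq _ _ _ _ (fun g => quotSupIso_mk M N g) (fun g hM hN => ?_) ?_ ?_
  · rw [← Subgroup.mem_bot, ← h]
    exact ⟨(QuotientGroup.eq_one_iff g).1 hM, (QuotientGroup.eq_one_iff g).1 hN⟩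
  · intro p l e
    obtain ⟨a, rfl⟩ := QuotientGroup.mk'_surjective M p
    obtain ⟨b, rfl⟩ := QuotientGroup.mk'_surjective N l
    have e1 := (quotSupIso_mk M N a).symm.trans e
    obtain ⟨z, hz, e2⟩ := QuotientGroup.eq.1 e1
    have e3 : a⁻¹ * b * z⁻¹ ∈ N := by
      rw [← QuotientGroup.eq_one_iff]
      simp only [QuotientGroup.mk_mul, QuotientGroup.mk_inv]
      have : (z : G ⧸ N) = (a : G ⧸ N)⁻¹ * b := e2
      rw [this, mul_inv_cancel]
    have e4 : a⁻¹ * b ∈ M ⊔ N := by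
      have := mul_mem (Subgroup.mem_sup_right (S := M) e3) hz
      simpa using this
    -- The common lift is `a * m`: it agrees with `a` modulo `M`, and `(a * m)⁻¹ * b = n` lies in
    -- `N`.
    obtain ⟨m, hm, n, hn, e5⟩ := Subgroup.mem_sup_of_normal_right.1 e4
    refine ⟨a * m, ?_, ?_⟩
    · exact (QuotientGroup.eq.2 (by simpa using hm)).symm
    · refine QuotientGroup.eq.2 ?_
      have : (a * m)⁻¹ * b = n := by
        rw [mul_inv_rev, mul_assoc, ← e5, inv_mul_cancel_left]
      rwa [this]
  · intro g
    obtain ⟨l, rfl⟩ := QuotientGroup.mk'_surjective _ g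
    exact ⟨1, l, by rw [map_one, mul_one]⟩

/-- Since `N ≤ H`, the preimage of `HN/N` in `G` is `H` itself, so `H` is the pullback. The quotient
map is onto, which leaves one double coset. `image_psh_pll` is the transposed square. -/
theorem psh_pll_image (H N : Subgroup G) [N.Normal] (h : N ≤ H) :
    psh (QuotientGroup.mk' N) ≫ pll (imageMod H N).subtype =
      pll H.subtype ≫ psh ((QuotientGroup.mk' N).subgroupMap H) := by
  refine psh_pll_eq _ _ _ _ (fun g => rfl) (fun g hH _ => Subtype.ext hH) ?_ ?_
  · rintro p ⟨_, g, hg, rfl⟩ e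
    have hp : p ∈ H := by
      have := mul_mem hg (inv_mem (h (QuotientGroup.eq.1 (show (p : G ⧸ N) = g from e))))
      simpa using this
    exact ⟨⟨p, hp⟩, rfl, Subtype.ext e⟩
  · intro g
    obtain ⟨p, rfl⟩ := QuotientGroup.mk'_surjective _ g
    exact ⟨p, 1, by rw [map_one, one_mul]⟩

theorem image_psh_pll (H N : Subgroup G) [N.Normal] (h : N ≤ H) :
    psh (imageMod H N).subtype ≫ pll (QuotientGroup.mk' N) =
      pll ((QuotientGroup.mk' N).subgroupMap H) ≫ psh H.subtype := by
  refine psh_pll_eq _ _ _ _ (fun g => rfl) (fun g _ hH => Subtype.ext hH) ?_ ?_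
  · rintro ⟨_, g, hg, rfl⟩ p e
    have hp : p ∈ H := by
      have := mul_mem hg (h (QuotientGroup.eq.1 (show (g : G ⧸ N) = p from e)))
      simpa using this
    exact ⟨⟨p, hp⟩, Subtype.ext e.symm, rfl⟩
  · intro g
    obtain ⟨p, rfl⟩ := QuotientGroup.mk'_surjective _ g
    exact ⟨1, p, by rw [map_one, mul_one]⟩

end SpanIdentities

/-- Relations whose factors can all be read covariantly, or all contravariantly, reduce to an
equality of two homomorphisms. The exceptions are `iso_inner`, a natural isomorphism between
functors, and the four mixed relations `mackey`, `infl_defl`, `defl_res` and `infl_ind`, which are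
base change squares. -/
theorem relationsHold (k : Type w) [CommRing k] : RelationsHold k := by
  intro X Y a b h
  cases h with
  | res_top G => exact (realizes_res _).map_eq (realizes_iso' _) rfl
  | ind_top G => exact (realizes_ind _).map_eq (realizes_iso _) rfl
  | defl_bot G => exact (realizes_defl _).map_eq (realizes_iso _) rfl
  | infl_bot G =>
    exact (realizes_infl _).map_eq (realizes_iso' _) rfl
  | iso_inner x =>
    exact (realizes_iso _).map_eq (Realizes.id _)
      ((psh_congr (MonoidHom.id _) _ x fun _ => rfl).symm.trans psh_id)
  | res_res K H h =>
    refine ((realizes_res _).comp ((realizes_res _).comp (realizes_iso' _))).map_eq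
      (realizes_res _) ?_
    rw [pll_comp, pll_comp]; rfl
  | ind_ind K H h =>
    refine ((realizes_iso _).comp ((realizes_ind _).comp (realizes_ind _))).map_eq
      (realizes_ind _) ?_
    rw [psh_comp, psh_comp]; rfl
  | iso_iso f f' =>
    exact ((realizes_iso _).comp (realizes_iso _)).map_eq (realizes_iso _) (psh_comp _ _)
  | infl_infl N M h =>
    refine ((realizes_iso' _).comp ((realizes_infl _).comp (realizes_infl _))).map_eq
      (realizes_infl _) ?_
    rw [pll_comp, pll_comp]; rfl
  | defl_defl N M h =>
    refine ((realizes_defl _).comp ((realizes_defl _).comp (realizes_iso _))).map_eq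
      (realizes_defl _) ?_
    rw [psh_comp, psh_comp]; rfl
  | res_iso K f =>
    refine ((realizes_res _).comp (realizes_iso' _)).map_eq
      ((realizes_iso' _).comp (realizes_res _)) ?_
    rw [pll_comp, pll_comp]
    congr 1
  | ind_iso K f =>
    refine ((realizes_ind _).comp (realizes_iso _)).map_eq
      ((realizes_iso _).comp (realizes_ind _)) ?_
    rw [psh_comp, psh_comp]; rfl
  | defl_iso N f N' h =>
    refine ((realizes_defl _).comp (realizes_iso _)).map_eq
      ((realizes_iso _).comp (realizes_defl _)) ?_
    rw [psh_comp, psh_comp]; rfl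
  | infl_iso N f N' h =>
    refine ((realizes_infl _).comp (realizes_iso' _)).map_eq
      ((realizes_iso' _).comp (realizes_infl _)) ?_
    rw [pll_comp, pll_comp]; rfl
  | mackey H K R hR =>
    refine ((realizes_ind _).comp (realizes_res _)).map_eq
      (Realizes.sum R fun x => (realizes_res _).comp ((realizes_iso _).comp (realizes_ind _))) ?_
    exact psh_pll_mackey H K R hR
  | infl_defl M N h =>
    refine ((realizes_infl _).comp (realizes_defl _)).map_eq
      ((realizes_defl _).comp ((realizes_iso _).comp (realizes_infl _))) ?_
    rw [pll_psh_quotient M N h, ← psh_comp, Category.assoc]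
  | ind_defl H N =>
    refine ((realizes_ind _).comp (realizes_defl _)).map_eq
      ((realizes_defl _).comp ((realizes_iso _).comp (realizes_ind _))) ?_
    rw [psh_comp, psh_comp, psh_comp]; rfl
  | infl_res H N =>
    refine ((realizes_infl _).comp (realizes_res _)).map_eq
      ((realizes_res _).comp ((realizes_iso' _).comp (realizes_infl _))) ?_
    rw [pll_comp, pll_comp, pll_comp]; rfl
  | defl_res H N h =>
    refine ((realizes_defl _).comp (realizes_res _)).map_eq
      ((realizes_res _).comp ((realizes_defl _).comp (realizes_iso _))) ?_
    rw [psh_pll_image H N h, psh_comp]; rfl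
  | infl_ind H N h =>
    refine ((realizes_infl _).comp (realizes_ind _)).map_eq
      ((realizes_iso' _).comp ((realizes_ind _).comp (realizes_infl _))) ?_
    rw [image_psh_pll H N h, ← Category.assoc, pll_comp, quotIso_symm_mk]

end Relations

/-! ### Functoriality from the relations of one variance -/

/-- A covariant system on finite groups: inductions, deflations and isomorphisms in a category,
subject to the relations which involve no restriction and no inflation. -/
structure PushSystem (C : Type*) [Category C] where
  obj : ∀ (G : Type) [Group G] [Finite G], C
  ind : ∀ {G : Type} [Group G] [Finite G] (H : Subgroup G), obj H ⟶ obj G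
  defl : ∀ {G : Type} [Group G] [Finite G] (N : Subgroup G) [N.Normal], obj G ⟶ obj (G ⧸ N)
  iso : ∀ {G G' : Type} [Group G] [Finite G] [Group G'] [Finite G'] (_ : G ≃* G'), obj G ⟶ obj G'
  ind_top : ∀ (G : Type) [Group G] [Finite G],
    ind (⊤ : Subgroup G) = iso (Subgroup.topEquiv (G := G))
  defl_bot : ∀ (G : Type) [Group G] [Finite G],
    defl (⊥ : Subgroup G) = iso (QuotientGroup.quotientBot (G := G)).symm
  iso_inner : ∀ {G : Type} [Group G] [Finite G] (x : G), iso (MulAut.conj x : G ≃* G) = 𝟙 _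
  ind_ind : ∀ {G : Type} [Group G] [Finite G] (K H : Subgroup G) (h : K ≤ H),
    iso (Subgroup.subgroupOfEquivOfLe h).symm ≫ ind (K.subgroupOf H) ≫ ind H = ind K
  iso_iso : ∀ {G G' G'' : Type} [Group G] [Finite G] [Group G'] [Finite G'] [Group G'']
    [Finite G''] (f : G ≃* G') (f' : G' ≃* G''), iso f ≫ iso f' = iso (f.trans f')
  defl_defl : ∀ {G : Type} [Group G] [Finite G] (N M : Subgroup G) [N.Normal] [M.Normal]
    (h : N ≤ M), defl N ≫ defl (M.map (QuotientGroup.mk' N)) ≫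
      iso (QuotientGroup.quotientQuotientEquivQuotient N M h) = defl M
  ind_iso : ∀ {G G' : Type} [Group G] [Finite G] [Group G'] [Finite G'] (K : Subgroup G)
    (f : G ≃* G'), ind K ≫ iso f = iso (f.subgroupMap K) ≫ ind (K.map (f : G →* G'))
  defl_iso : ∀ {G G' : Type} [Group G] [Finite G] [Group G'] [Finite G'] (N : Subgroup G)
    [N.Normal] (f : G ≃* G') (N' : Subgroup G') [N'.Normal] (h : N.map (f : G →* G') = N'),
    defl N ≫ iso (QuotientGroup.congr N N' f h) = iso f ≫ defl N'
  ind_defl : ∀ {G : Type} [Group G] [Finite G] (H N : Subgroup G) [N.Normal],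
    ind H ≫ defl N = defl (N.subgroupOf H) ≫ iso (quotIso H N) ≫ ind (imageMod H N)

namespace PushSystem

variable {C : Type*} [Category C] (S : PushSystem C)

section

variable {G H K L : Type} [Group G] [Finite G] [Group H] [Finite H] [Group K] [Finite K]
  [Group L] [Finite L]

theorem iso_refl : S.iso (MulEquiv.refl G) = 𝟙 _ := by
  rw [← S.iso_inner (1 : G)]
  congr 1
  ext x
  simp

@[simp]
theorem iso_symm_comp (f : G ≃* H) : S.iso f.symm ≫ S.iso f = 𝟙 _ := by
  rw [S.iso_iso, MulEquiv.symm_trans_self, S.iso_refl]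

@[simp]
theorem iso_comp_symm (f : G ≃* H) : S.iso f ≫ S.iso f.symm = 𝟙 _ := by
  rw [S.iso_iso, MulEquiv.self_trans_symm, S.iso_refl]

@[simp]
theorem iso_symm_comp_assoc (f : G ≃* H) {Z : C} (t : S.obj H ⟶ Z) :
    S.iso f.symm ≫ S.iso f ≫ t = t := by
  rw [← Category.assoc, iso_symm_comp, Category.id_comp]

@[simp]
theorem iso_comp_symm_assoc (f : G ≃* H) {Z : C} (t : S.obj G ⟶ Z) :
    S.iso f ≫ S.iso f.symm ≫ t = t := by
  rw [← Category.assoc, iso_comp_symm, Category.id_comp]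

/-- The map of an arbitrary homomorphism: deflation to the quotient by the kernel, followed by the
induction from the range. -/
noncomputable def push (f : G →* H) : S.obj G ⟶ S.obj H :=
  S.defl f.ker ≫ S.iso (QuotientGroup.quotientKerEquivRange f) ≫ S.ind f.range

/-- The map of a homomorphism may be computed through any factorization as a quotient map, an
isomorphism and an inclusion. -/
theorem push_eq (f : G →* H) (N : Subgroup G) [N.Normal] (I : Subgroup H) (e : G ⧸ N ≃* I)
    (h : ∀ g : G, (e g : H) = f g) : S.push f = S.defl N ≫ S.iso e ≫ S.ind I := by
  obtain rfl : N = f.ker := by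
    ext g
    rw [MonoidHom.mem_ker, ← h, ← QuotientGroup.eq_one_iff, OneMemClass.coe_eq_one,
      EmbeddingLike.map_eq_one_iff]
  obtain rfl : I = f.range := by
    ext x
    constructor
    · intro hx
      obtain ⟨g, hg⟩ := QuotientGroup.mk_surjective (e.symm ⟨x, hx⟩)
      exact ⟨g, by rw [← h, hg, e.apply_symm_apply]⟩
    · rintro ⟨g, rfl⟩
      rw [← h]
      exact (e g).2
  have he : e = QuotientGroup.quotientKerEquivRange f := by
    ext x
    obtain ⟨g, rfl⟩ := QuotientGroup.mk_surjective x
    exact h g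
  rw [he]
  rfl

theorem push_defl (f : G →* H) (N : Subgroup G) [N.Normal] (e : G ⧸ N ≃* H)
    (h : ∀ g : G, e g = f g) : S.push f = S.defl N ≫ S.iso e := by
  rw [S.push_eq f N ⊤ (e.trans Subgroup.topEquiv.symm) h, S.ind_top, S.iso_iso]
  congr 2

theorem push_ind (f : G →* H) (I : Subgroup H) (e : G ≃* I) (h : ∀ g : G, (e g : H) = f g) :
    S.push f = S.iso e ≫ S.ind I := by
  rw [S.push_eq f ⊥ I (QuotientGroup.quotientBot.trans e) h, S.defl_bot, ← S.iso_iso]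
  simp

theorem push_iso (e : G ≃* H) : S.push e.toMonoidHom = S.iso e := by
  rw [S.push_ind e.toMonoidHom ⊤ (e.trans Subgroup.topEquiv.symm) (fun _ => rfl), S.ind_top,
    S.iso_iso]
  congr 1

theorem push_mk (N : Subgroup G) [N.Normal] : S.push (QuotientGroup.mk' N) = S.defl N := by
  rw [S.push_defl _ N (MulEquiv.refl _) (fun _ => rfl), S.iso_refl, Category.comp_id]

theorem push_subtype (I : Subgroup G) : S.push I.subtype = S.ind I := by
  rw [S.push_ind _ I (MulEquiv.refl _) (fun _ => rfl), S.iso_refl, Category.id_comp]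

/-- With `N = ker p` and `M = ker (q ∘ p)`, the isomorphism `G/N ≃ H` carries `M/N` to `ker q`.
Compatibility of deflations with this isomorphism turns the second deflation into one from `G/N`,
and transitivity of deflations finishes. -/
theorem push_comp_surjective_surjective (p : G →* H) (q : H →* K) (hp : Function.Surjective p)
    (hq : Function.Surjective q) : S.push (q.comp p) = S.push p ≫ S.push q := by
  let e := QuotientGroup.quotientKerEquivOfSurjective p hp
  let e' := QuotientGroup.quotientKerEquivOfSurjective q hq
  let N := p.ker
  let M := (q.comp p).ker
  have hNM : N ≤ M := fun x hx => by
    change q (p x) = 1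
    rw [show p x = 1 from hx, map_one]
  have hM : (M.map (QuotientGroup.mk' N)).map (e : G ⧸ N →* H) = q.ker := by
    rw [Subgroup.map_map]
    change M.map p = _
    ext y
    constructor
    · rintro ⟨x, hx, rfl⟩; exact hx
    · intro hy
      obtain ⟨x, rfl⟩ := hp y
      exact ⟨x, hy, rfl⟩
  rw [S.push_defl p N e (fun _ => rfl), S.push_defl q q.ker e' (fun _ => rfl), Category.assoc,
    ← Category.assoc (S.iso e), ← S.defl_iso _ e q.ker hM,
    S.push_defl (q.comp p) M ((QuotientGroup.quotientQuotientEquivQuotient N M hNM).symm.trans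
      ((QuotientGroup.congr _ _ e hM).trans e')) (fun _ => rfl), ← S.defl_defl N M hNM]
  simp [← S.iso_iso]

/-- Mirror image of the surjective case, with ranges in place of kernels: move the isomorphism onto
`j.range` past the induction from `i.range`, then use transitivity of inductions. -/
theorem push_comp_injective_injective (i : G →* H) (j : H →* K) (hi : Function.Injective i)
    (hj : Function.Injective j) : S.push (j.comp i) = S.push i ≫ S.push j := by
  let e := MonoidHom.ofInjective hi
  let e' := MonoidHom.ofInjective hj
  have hle : (j.comp i).range ≤ j.range := by
    rintro _ ⟨x, rfl⟩; exact ⟨i x, rfl⟩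
  have hI : i.range.map (e' : H →* j.range) = (j.comp i).range.subgroupOf j.range := by
    ext ⟨_, y, rfl⟩
    rw [Subgroup.mem_subgroupOf]
    constructor
    · rintro ⟨_, ⟨x, rfl⟩, hx⟩
      exact ⟨x, congrArg Subtype.val hx⟩
    · rintro ⟨x, hx⟩
      exact ⟨i x, ⟨x, rfl⟩, Subtype.ext hx⟩
  rw [S.push_ind i i.range e (fun _ => rfl), S.push_ind j j.range e' (fun _ => rfl),
    Category.assoc, ← Category.assoc (S.ind _), S.ind_iso]
  generalize_proofs
  rw [S.push_ind (j.comp i) _ ((e.trans (e'.subgroupMap i.range)).trans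
    ((MulEquiv.subgroupCongr hI).trans (Subgroup.subgroupOfEquivOfLe hle))) (fun _ => rfl),
    ← S.ind_ind _ _ hle]
  -- The two descriptions of the subgroup of `j.range` are equal only propositionally, so the
  -- comparison isomorphism has to be absorbed into the induction.
  have hind : ∀ (A B : Subgroup j.range) (h : A = B),
      S.iso (MulEquiv.subgroupCongr h) ≫ S.ind B = S.ind A := by
    rintro A _ rfl
    rw [← S.push_ind A.subtype A _ (fun _ => rfl), S.push_subtype]
  rw [← hind _ _ hI]
  simp [← S.iso_iso]

theorem push_comp_injective_surjective (p : G →* H) (j : H →* K) (hp : Function.Surjective p)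
    (hj : Function.Injective j) : S.push (j.comp p) = S.push p ≫ S.push j := by
  let f := QuotientGroup.quotientKerEquivOfSurjective p hp
  let f' := MonoidHom.ofInjective hj
  rw [S.push_defl p _ f (fun _ => rfl), S.push_ind j _ f' (fun _ => rfl),
    S.push_eq (j.comp p) p.ker j.range (f.trans f') (fun _ => rfl)]
  simp [← S.iso_iso]

/-- Deflation past induction, for a commutative square. -/
theorem push_exchange (i : G →* H) (q : H →* K) (p : G →* L) (j : L →* K)
    (hi : Function.Injective i) (hq : Function.Surjective q) (hp : Function.Surjective p)
    (hj : Function.Injective j) (comm : q.comp i = j.comp p) :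
    S.push i ≫ S.push q = S.push p ≫ S.push j := by
  let e := MonoidHom.ofInjective hi
  let e' := QuotientGroup.quotientKerEquivOfSurjective q hq
  let I := i.range
  let N := q.ker
  have hN : p.ker.map (e : G →* I) = N.subgroupOf I := by
    ext ⟨_, y, rfl⟩
    rw [Subgroup.mem_subgroupOf]
    change _ ↔ q (i y) = 1
    rw [show q (i y) = j (p y) from DFunLike.congr_fun comm y, map_eq_one_iff j hj]
    constructor
    · rintro ⟨x, hx, hxy⟩
      obtain rfl : x = y := e.injective hxy
      exact hx
    · intro h
      exact ⟨y, h, rfl⟩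
  -- After replacing `i` by a subgroup inclusion and `q` by a quotient map, `ind_defl` interchanges
  -- them, and `defl_iso` and `ind_iso` gather the isomorphisms in the middle.
  have key : S.push i ≫ S.push q = S.defl p.ker ≫ S.iso ((QuotientGroup.congr _ _ e hN).trans
      ((quotIso I N).trans (e'.subgroupMap _))) ≫ S.ind _ := by
    rw [S.push_ind i I e (fun _ => rfl), S.push_defl q N e' (fun _ => rfl), Category.assoc,
      ← Category.assoc (S.ind _), S.ind_defl, Category.assoc, Category.assoc, S.ind_iso,
      ← Category.assoc (S.iso e), ← S.defl_iso _ e _ hN]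
    simp [← S.iso_iso]
  -- The resulting string is a factorization of `q.comp i`, hence depends only on this homomorphism,
  -- which is also `j.comp p`.
  rw [key, ← S.push_eq (q.comp i) _ _ _ (fun _ => rfl), comm,
    S.push_comp_injective_surjective p j hp hj]

/-- Write `f = i p` and `g = j q` as surjections followed by inclusions, and factor `q i = m t`
likewise. Then `g f = (j m)(t p)`, and the only interchange needed is that of `i` and `q` with `t`
and `m`. -/
theorem push_comp (f : G →* H) (g : H →* K) : S.push (g.comp f) = S.push f ≫ S.push g := by
  let p := f.rangeRestrict
  let i := f.range.subtype
  let q := g.rangeRestrict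
  let j := g.range.subtype
  let t := (q.comp i).rangeRestrict
  let m := (q.comp i).range.subtype
  have hp : Function.Surjective p := f.rangeRestrict_surjective
  have hq : Function.Surjective q := g.rangeRestrict_surjective
  have ht : Function.Surjective t := (q.comp i).rangeRestrict_surjective
  have hi : Function.Injective i := Subtype.val_injective
  have hj : Function.Injective j := Subtype.val_injective
  have hm : Function.Injective m := Subtype.val_injective
  have htp : Function.Surjective (t.comp p) := ht.comp hp
  have hjm : Function.Injective (j.comp m) := hj.comp hm
  rw [show g.comp f = (j.comp m).comp (t.comp p) from rfl,
    S.push_comp_injective_surjective _ _ htp hjm,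
    S.push_comp_surjective_surjective _ _ hp ht, S.push_comp_injective_injective _ _ hm hj,
    show S.push f = S.push p ≫ S.push i from S.push_comp_injective_surjective p i hp hi,
    show S.push g = S.push q ≫ S.push j from S.push_comp_injective_surjective q j hq hj,
    Category.assoc, Category.assoc, ← Category.assoc (S.push i),
    S.push_exchange i q t m hi hq ht hm rfl, Category.assoc]

theorem push_conj (u v : G →* H) (x : H) (h : ∀ a, v a = x * u a * x⁻¹) :
    S.push u = S.push v := by
  have : v = (MulAut.conj x).toMonoidHom.comp u := MonoidHom.ext h
  rw [this, S.push_comp]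
  exact ((congrArg (fun t => S.push u ≫ t) ((S.push_iso _).trans (S.iso_inner x))).trans
    (Category.comp_id _)).symm

theorem push_id : S.push (MonoidHom.id G) = 𝟙 _ :=
  (S.push_iso (MulEquiv.refl G)).trans S.iso_refl

end

end PushSystem

/-! ### Covariant and contravariant maps in the presented category -/

section Presented

variable (k : Type w) [CommRing k]

/-- The quotient functor from formal linear combinations of strings of elementary spans to the
presented category. -/
noncomputable abbrev quo : FreeSpan k ⥤ Presented k := CategoryTheory.Quotient.functor (relCongr k)

/-- A finite group as an object of the presented category. -/
noncomputable abbrev pObj (G : Type) [Group G] [Finite G] : Presented k := (quo k).obj (gp k G)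

theorem quo_map_eq_iff {X Y : FreeSpan k} (a b : X ⟶ Y) :
    (quo k).map a = (quo k).map b ↔ a - b ∈ relIdeal k X Y :=
  CategoryTheory.Quotient.functor_map_eq_iff (relCongr k) a b

variable {k}

theorem Rel.quo_map_eq {X Y : FreeSpan k} {a b : X ⟶ Y} (h : Rel k a b) :
    (quo k).map a = (quo k).map b :=
  (quo_map_eq_iff k a b).2 (Submodule.subset_span ⟨X, Y, 𝟙 X, a, b, 𝟙 Y, h, by simp⟩)

section
variable {G G' : Type} [Group G] [Finite G] [Group G'] [Finite G']

theorem quo_iso_refl : (quo k).map (iso k (MulEquiv.refl G)) = 𝟙 _ := by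
  rw [← (quo k).map_id, ← (Rel.iso_inner (k := k) (1 : G)).quo_map_eq]
  congr 2
  ext x
  simp

theorem quo_iso_symm_comp (f : G ≃* G') :
    (quo k).map (iso k f.symm) ≫ (quo k).map (iso k f) = 𝟙 _ := by
  rw [← Functor.map_comp, (Rel.iso_iso f.symm f).quo_map_eq, MulEquiv.symm_trans_self,
    quo_iso_refl]

theorem quo_iso_comp_symm (f : G ≃* G') :
    (quo k).map (iso k f) ≫ (quo k).map (iso k f.symm) = 𝟙 _ :=
  quo_iso_symm_comp f.symm

/-- An isomorphism of groups as an isomorphism in the presented category. -/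
noncomputable def quoIso (f : G ≃* G') : pObj k G ≅ pObj k G' where
  hom := (quo k).map (iso k f)
  inv := (quo k).map (iso k f.symm)
  hom_inv_id := quo_iso_comp_symm f
  inv_hom_id := quo_iso_symm_comp f

end

variable (k)

/-- The inductions, deflations and isomorphisms in the presented category. -/
noncomputable def pushSystem : PushSystem (Presented k) where
  obj G := pObj k G
  ind H := (quo k).map (ind k H)
  defl N := (quo k).map (defl k N)
  iso f := (quo k).map (iso k f)
  ind_top G := (Rel.ind_top G).quo_map_eq
  defl_bot G := (Rel.defl_bot G).quo_map_eq
  iso_inner x := (Rel.iso_inner x).quo_map_eq.trans ((quo k).map_id _)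
  ind_ind K H h := by
    rw [← Functor.map_comp, ← Functor.map_comp]; exact (Rel.ind_ind K H h).quo_map_eq
  iso_iso f f' := by rw [← Functor.map_comp]; exact (Rel.iso_iso f f').quo_map_eq
  defl_defl N M _ _ h := by
    rw [← Functor.map_comp, ← Functor.map_comp]; exact (Rel.defl_defl N M h).quo_map_eq
  ind_iso K f := by
    rw [← Functor.map_comp, ← Functor.map_comp]; exact (Rel.ind_iso K f).quo_map_eq
  defl_iso N _ f N' _ h := by
    rw [← Functor.map_comp, ← Functor.map_comp]; exact (Rel.defl_iso N f N' h).quo_map_eq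
  ind_defl H N _ := by
    rw [← Functor.map_comp, ← Functor.map_comp, ← Functor.map_comp]
    exact (Rel.ind_defl H N).quo_map_eq

/-- The restrictions, inflations and isomorphisms in the opposite of the presented category. -/
noncomputable def pullSystem : PushSystem (Presented k)ᵒᵖ where
  obj G := .op (pObj k G)
  ind H := ((quo k).map (res k H)).op
  defl N := ((quo k).map (infl k N)).op
  -- The inverse compensates for the reversal of arrows, so that `iso` is covariant in the opposite
  -- category.
  iso f := ((quo k).map (iso k f.symm)).op
  ind_top G := congrArg Quiver.Hom.op (Rel.res_top G).quo_map_eq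
  defl_bot G := congrArg Quiver.Hom.op (Rel.infl_bot G).quo_map_eq
  iso_inner x := congrArg Quiver.Hom.op (by
    rw [← (quo k).map_id, ← (Rel.iso_inner x⁻¹).quo_map_eq]
    congr 2
    ext y
    simp)
  ind_ind K H h := by
    rw [← op_comp, ← op_comp, Category.assoc, ← Functor.map_comp, ← Functor.map_comp]
    exact congrArg Quiver.Hom.op (Rel.res_res K H h).quo_map_eq
  iso_iso f f' := by
    rw [← op_comp, ← Functor.map_comp]
    exact congrArg Quiver.Hom.op (Rel.iso_iso f'.symm f.symm).quo_map_eq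
  defl_defl N M _ _ h := by
    rw [← op_comp, ← op_comp, Category.assoc, ← Functor.map_comp, ← Functor.map_comp]
    exact congrArg Quiver.Hom.op (Rel.infl_infl N M h).quo_map_eq
  ind_iso K f := by
    rw [← op_comp, ← op_comp]
    -- The required identity involves inverse isomorphisms; moving them to the other sides turns it
    -- into `Rel.res_iso` for `f`.
    refine congrArg Quiver.Hom.op ((quoIso f).inv_comp_eq.2 ?_)
    rw [← Category.assoc]
    refine (quoIso (f.subgroupMap K)).eq_comp_inv.2 ?_
    exact ((quo k).map_comp _ _).symm.trans
      ((Rel.res_iso K f).quo_map_eq.trans ((quo k).map_comp _ _))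
  defl_iso N _ f N' _ h := by
    rw [← op_comp, ← op_comp]
    refine congrArg Quiver.Hom.op ((quoIso (QuotientGroup.congr N N' f h)).inv_comp_eq.2 ?_)
    rw [← Category.assoc]
    refine (quoIso f).eq_comp_inv.2 ?_
    exact ((quo k).map_comp _ _).symm.trans
      ((Rel.infl_iso N f N' h).quo_map_eq.trans ((quo k).map_comp _ _))
  ind_defl H N _ := by
    rw [← op_comp, ← op_comp, ← op_comp, Category.assoc, ← Functor.map_comp, ← Functor.map_comp,
      ← Functor.map_comp]
    exact congrArg Quiver.Hom.op (Rel.infl_res H N).quo_map_eq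

section
variable {G H L P P' : Type} [Group G] [Finite G] [Group H] [Finite H] [Group L] [Finite L]
  [Group P] [Finite P] [Group P'] [Finite P']

/-- The covariant map of a homomorphism in the presented category. -/
noncomputable def push (u : G →* H) : pObj k G ⟶ pObj k H := (pushSystem k).push u

/-- The contravariant map of a homomorphism in the presented category. -/
noncomputable def pull (u : G →* H) : pObj k H ⟶ pObj k G := ((pullSystem k).push u).unop

theorem push_comp (u : G →* H) (v : H →* L) : push k (v.comp u) = push k u ≫ push k v :=
  (pushSystem k).push_comp u v

theorem pull_comp (u : G →* H) (v : H →* L) : pull k (v.comp u) = pull k v ≫ pull k u :=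
  congrArg Quiver.Hom.unop ((pullSystem k).push_comp u v)

theorem push_conj (u v : G →* H) (x : H) (h : ∀ a, v a = x * u a * x⁻¹) :
    push k u = push k v := (pushSystem k).push_conj u v x h

theorem pull_conj (u v : G →* H) (x : H) (h : ∀ a, v a = x * u a * x⁻¹) :
    pull k u = pull k v := congrArg Quiver.Hom.unop ((pullSystem k).push_conj u v x h)

theorem push_id : push k (MonoidHom.id G) = 𝟙 _ := (pushSystem k).push_id

theorem pull_id : pull k (MonoidHom.id G) = 𝟙 _ :=
  congrArg Quiver.Hom.unop (pullSystem k).push_id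

theorem push_iso (f : G ≃* H) : push k f.toMonoidHom = (quo k).map (iso k f) :=
  (pushSystem k).push_iso f

theorem pull_iso (f : G ≃* H) : pull k f.toMonoidHom = (quo k).map (iso k f.symm) :=
  congrArg Quiver.Hom.unop ((pullSystem k).push_iso f)

theorem push_mk (N : Subgroup G) [N.Normal] :
    push k (QuotientGroup.mk' N) = (quo k).map (defl k N) :=
  (pushSystem k).push_mk N

theorem pull_mk (N : Subgroup G) [N.Normal] :
    pull k (QuotientGroup.mk' N) = (quo k).map (infl k N) :=
  congrArg Quiver.Hom.unop ((pullSystem k).push_mk N)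

theorem push_subtype (H : Subgroup G) : push k H.subtype = (quo k).map (ind k H) :=
  (pushSystem k).push_subtype H

theorem pull_subtype (H : Subgroup G) : pull k H.subtype = (quo k).map (res k H) :=
  congrArg Quiver.Hom.unop ((pullSystem k).push_subtype H)

theorem push_equiv (f : G ≃* H) : push k f.toMonoidHom = pull k f.symm.toMonoidHom :=
  (push_iso k f).trans (pull_iso k f.symm).symm

theorem pull_equiv_comp_push (f : G ≃* H) :
    pull k f.toMonoidHom ≫ push k f.toMonoidHom = 𝟙 _ := by
  rw [push_iso, pull_iso, quo_iso_symm_comp]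

/-- The map represented by a pair of homomorphisms `G ⟵ P ⟶ H` only depends on its isomorphism
class. -/
theorem pull_push_congr (e : P ≃* P') (u : P →* G) (v : P →* H) (u' : P' →* G) (v' : P' →* H)
    (x : G) (y : H) (hu : ∀ p, u' (e p) = x * u p * x⁻¹) (hv : ∀ p, v' (e p) = y * v p * y⁻¹) :
    pull k u ≫ push k v = pull k u' ≫ push k v' := by
  rw [pull_conj k u (u'.comp e.toMonoidHom) x hu, push_conj k v (v'.comp e.toMonoidHom) y hv,
    pull_comp, push_comp, Category.assoc, ← Category.assoc (pull k e.toMonoidHom),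
    pull_equiv_comp_push, Category.id_comp]

end

end Presented

/-! ### Components of the middle groupoid -/

section Components

instance endFinite (A : FinGpd) (x : A) : Finite (End x) := A.finite_hom x x

/-- The homomorphism on an automorphism group induced by a functor to a group. -/
def endHom {A : FinGpd} {G : Type} [Group G] (F : A ⥤ SingleObj G) (x : A) : End x →* G where
  toFun f := F.map f
  map_one' := F.map_id x
  -- Multiplication in `End` and composition in `SingleObj` both reverse the order, so no opposite
  -- group appears.
  map_mul' f g := F.map_comp g f

variable (A : FinGpd)

/-- The isomorphism classes of objects of a groupoid. -/
abbrev FinGpd.Component : Type := Quotient (isIsomorphicSetoid A)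

noncomputable instance : Fintype A.Component :=
  have : Finite A.Component := Quotient.finite _
  Fintype.ofFinite _

/-- A representative of an isomorphism class of objects. -/
noncomputable def FinGpd.rep (c : A.Component) : A := c.out

theorem FinGpd.rep_iso (x : A) :
    Nonempty (A.rep (Quotient.mk (isIsomorphicSetoid A) x) ≅ x) :=
  Quotient.mk_out (s := isIsomorphicSetoid A) x

theorem FinGpd.eq_of_rep_hom (c d : A.Component) (f : A.rep c ⟶ A.rep d) : c = d := by
  rw [← Quotient.out_eq c, ← Quotient.out_eq d]
  exact Quotient.sound ⟨(Groupoid.isoEquivHom _ _).symm f⟩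

/-- The inclusion of the automorphism group of an object. -/
def FinGpd.endFunctor (x : A) : (FinGp.of (End x)).toGpd ⥤ A :=
  SingleObj.functor (MonoidHom.id (End x))

instance (x : A) : (A.endFunctor x).Full := ⟨fun {_ _} f => ⟨f, rfl⟩⟩

instance (x : A) : (A.endFunctor x).Faithful := ⟨fun {_ _} _ _ h => h⟩

theorem PreSpan.cls_eq_sum_components {X Y : FinGpd} (S : PreSpan X Y) :
    S.cls = ∑ c : S.mid.Component, PreSpan.cls ⟨(FinGp.of (End (S.mid.rep c))).toGpd,
      S.mid.endFunctor (S.mid.rep c) ⋙ S.l, S.mid.endFunctor (S.mid.rep c) ⋙ S.r⟩ :=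
  S.cls_eq_sum _ (fun c => S.mid.endFunctor (S.mid.rep c)) (fun _ => inferInstance)
    (fun _ => inferInstance) (fun c d h _ _ f => h (S.mid.eq_of_rep_hom c d f))
    (fun s => by
      let c : S.mid.Component := Quotient.mk _ s
      exact ⟨c, SingleObj.star (End (S.mid.rep c)), ⟨(S.mid.rep_iso s).some.hom⟩⟩)

/-- Every span between groups is a sum of spans with a group in the middle. -/
theorem span_induction {G H : FinGp} {p : (G.toGpd ⟶ H.toGpd) → Prop}
    (pll_psh : ∀ (P : Type) [Group P] [Finite P] (u : P →* G.carrier) (v : P →* H.carrier),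
      p (pll u ≫ psh v))
    (zero : p 0) (add : ∀ s t, p s → p t → p (s + t)) (s : G.toGpd ⟶ H.toGpd) : p s := by
  obtain ⟨S, rfl⟩ := PreSpan.exists_cls s
  rw [S.cls_eq_sum_components]
  refine Finset.sum_induction _ p add zero fun c _ => ?_
  have := pll_psh (End (S.mid.rep c)) (endHom S.l _) (endHom S.r _)
  rw [SpanPres.pll_psh] at this
  exact this

end Components

/-! ### Evaluating spans of groups in the presented category -/

section Evaluation

variable (k : Type w) [CommRing k] {G H L : FinGp}

/-- The contribution of a component of the middle groupoid of a span. -/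
noncomputable def term (S : PreSpan G.toGpd H.toGpd) (x : S.mid) :
    pObj k G.carrier ⟶ pObj k H.carrier :=
  pull k (endHom S.l x) ≫ push k (endHom S.r x)

theorem mul_eq_conj {G : Type} [Group G] {a b x : G} (h : x * a = b * x) : b = x * a * x⁻¹ :=
  eq_mul_inv_of_mul_eq h.symm

/-- The components of `α` and `β` are elements of `G` and `H`, and naturality says that they
conjugate the homomorphisms of one span into those of the other. Triviality of inner automorphisms
makes the contribution insensitive to this. -/
theorem term_functor {S T : PreSpan G.toGpd H.toGpd} (F : S.mid ⥤ T.mid) [F.Full] [F.Faithful]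
    (α : S.l ≅ F ⋙ T.l) (β : S.r ≅ F ⋙ T.r) (x : S.mid) : term k S x = term k T (F.obj x) :=
  pull_push_congr k ((Functor.FullyFaithful.ofFullyFaithful F).mulEquivEnd x) _ _ _ _
    (α.hom.app x) (β.hom.app x) (fun p => mul_eq_conj (α.hom.naturality p))
    (fun p => mul_eq_conj (β.hom.naturality p))

/-- Conjugation by `e` identifies the two automorphism groups, and the images of `e` in `G` and `H`
conjugate the legs. A contribution therefore depends only on the component. -/
theorem term_iso (S : PreSpan G.toGpd H.toGpd) {x y : S.mid} (e : x ≅ y) :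
    term k S x = term k S y := by
  have key : ∀ {K : FinGp} (F : S.mid ⥤ K.toGpd) (p : End x),
      (show K.carrier from F.map e.hom) * endHom F x p =
        endHom F y (e.conj p) * (show K.carrier from F.map e.hom) := by
    intro K F p
    have : F.map p ≫ F.map e.hom = F.map e.hom ≫ F.map (e.conj p) := by
      rw [← F.map_comp, ← F.map_comp, Iso.conj_apply, Iso.hom_inv_id_assoc]
    exact this
  exact pull_push_congr k e.conj _ _ _ _ (S.l.map e.hom) (S.r.map e.hom)
    (fun p => mul_eq_conj (key S.l p)) (fun p => mul_eq_conj (key S.r p))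

/-- The sum of the contributions of all components of the middle groupoid. -/
noncomputable def total (S : PreSpan G.toGpd H.toGpd) : pObj k G.carrier ⟶ pObj k H.carrier :=
  ∑ c : S.mid.Component, term k S (S.mid.rep c)

/-- Frees `total` from the chosen representatives, so that invariance under equivalence and
additivity can be checked on any convenient ones. -/
theorem total_eq_sum (S : PreSpan G.toGpd H.toGpd) {J : Type*} [Fintype J] (x : J → S.mid)
    (disj : ∀ i j, (x i ⟶ x j) → i = j) (cover : ∀ s, ∃ j, Nonempty (x j ⟶ s)) :
    total k S = ∑ j, term k S (x j) := by
  refine (Fintype.sum_bijective (fun j => Quotient.mk (isIsomorphicSetoid S.mid) (x j))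
    ⟨fun i j h => ?_, fun c => ?_⟩ _ _ fun j => ?_).symm
  · exact disj i j (Quotient.exact (s := isIsomorphicSetoid S.mid) h).some.hom
  · obtain ⟨s, rfl⟩ := Quotient.exists_rep c
    obtain ⟨j, ⟨f⟩⟩ := cover s
    exact ⟨j, Quotient.sound ⟨(Groupoid.isoEquivHom _ _).symm f⟩⟩
  · exact (term_iso k S (S.mid.rep_iso (x j)).some).symm

theorem total_congr {S T : PreSpan G.toGpd H.toGpd} (h : PreSpan.Equiv S T) :
    total k S = total k T := by
  obtain ⟨F, hF, ⟨α⟩, ⟨β⟩⟩ := h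
  rw [total_eq_sum k T (fun c : S.mid.Component => F.obj (S.mid.rep c))
    (fun c d f => S.mid.eq_of_rep_hom c d (F.preimage f)) (fun t => by
      refine ⟨Quotient.mk (isIsomorphicSetoid S.mid) (F.objPreimage t), ⟨?_⟩⟩
      exact F.map (S.mid.rep_iso _).some.hom ≫ (F.objObjPreimageIso t).hom)]
  exact Finset.sum_congr rfl fun c _ => term_functor k F α β _

theorem total_add (S T : PreSpan G.toGpd H.toGpd) :
    total k (PreSpan.add S T) = total k S + total k T := by
  rw [total_eq_sum k (PreSpan.add S T) (J := S.mid.Component ⊕ T.mid.Component)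
    (Sum.map S.mid.rep T.mid.rep), Fintype.sum_sum_type]
  · congr 1
    · exact Finset.sum_congr rfl fun c _ => (term_functor (T := PreSpan.add S T) k
        (CategoryTheory.Sum.inl_ S.mid T.mid)
        (Functor.inlCompSum' _ _).symm (Functor.inlCompSum' _ _).symm _).symm
    · exact Finset.sum_congr rfl fun c _ => (term_functor (T := PreSpan.add S T) k
        (CategoryTheory.Sum.inr_ S.mid T.mid)
        (Functor.inrCompSum' _ _).symm (Functor.inrCompSum' _ _).symm _).symm
  · rintro (c | c) (d | d) f
    · exact congrArg _ (S.mid.eq_of_rep_hom c d f.down)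
    · exact f.elim
    · exact f.elim
    · exact congrArg _ (T.mid.eq_of_rep_hom c d f.down)
  · rintro (s | t)
    · exact ⟨.inl _, ⟨ULift.up (S.mid.rep_iso s).some.hom⟩⟩
    · exact ⟨.inr _, ⟨ULift.up (T.mid.rep_iso t).some.hom⟩⟩

/-- The map of the presented category represented by a span of groups. -/
noncomputable def eval (G H : FinGp) :
    (G.toGpd ⟶ H.toGpd) →+ (pObj k G.carrier ⟶ pObj k H.carrier) where
  toFun := Quotient.lift (total k) fun _ _ h => total_congr k h
  map_zero' := (total_eq_sum k (PreSpan.zero G.toGpd H.toGpd) (J := PEmpty.{1}) PEmpty.elim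
    (fun i => i.elim) (fun s => s.as.elim)).trans (Finset.sum_empty)
  map_add' := by rintro ⟨S⟩ ⟨T⟩; exact total_add k S T

theorem eval_pll_psh {P : Type} [Group P] [Finite P] (u : P →* G.carrier) (v : P →* H.carrier) :
    eval k G H (pll u ≫ psh v) = pull k u ≫ push k v := by
  rw [pll_psh]
  refine (total_eq_sum k ⟨(FinGp.of P).toGpd, u.toFunctor, v.toFunctor⟩ (J := Unit)
    (fun _ => SingleObj.star P) (fun _ _ _ => rfl) (fun s => ⟨(), ⟨𝟙 _⟩⟩)).trans ?_
  refine (Fintype.sum_unique _).trans ?_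
  let A : FinGpd := (FinGp.of P).toGpd
  let x : A := SingleObj.star P
  have := endFinite A x
  let e : P ≃* End x := SingleObj.toEnd P
  exact (pull_push_congr k e u v (endHom (A := A) u.toFunctor x) (endHom (A := A) v.toFunctor x) 1 1
    (fun p => by rw [one_mul, inv_one, mul_one]; rfl)
    (fun p => by rw [one_mul, inv_one, mul_one]; rfl)).symm

end Evaluation

/-! ### Composition and finite sums -/

section AddMonEnriched

variable {C : Type*} [Category C] [AddMonEnriched C] {X Y Z : C}

theorem AddMonEnriched.comp_sum {J : Type*} (R : Finset J) (f : X ⟶ Y) (g : J → (Y ⟶ Z)) :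
    f ≫ ∑ j ∈ R, g j = ∑ j ∈ R, f ≫ g j :=
  map_sum (⟨⟨fun g => f ≫ g, AddMonEnriched.comp_zero f⟩, AddMonEnriched.comp_add f⟩ :
    (Y ⟶ Z) →+ (X ⟶ Z)) g R

theorem AddMonEnriched.sum_comp {J : Type*} (R : Finset J) (f : J → (X ⟶ Y)) (g : Y ⟶ Z) :
    (∑ j ∈ R, f j) ≫ g = ∑ j ∈ R, f j ≫ g :=
  map_sum (⟨⟨fun f => f ≫ g, AddMonEnriched.zero_comp g⟩,
    fun f f' => AddMonEnriched.add_comp f f' g⟩ : (X ⟶ Y) →+ (X ⟶ Z)) f R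

end AddMonEnriched

/-! ### Base change in the presented category and functoriality of evaluation -/

section BaseChange

section Existence

variable {G L P : Type} [Group G] [Finite G] [Group L] [Finite L] [Group P] [Finite P]

theorem exists_doubleCoset_representatives (H K : Subgroup G) :
    ∃ R : Finset G, ∀ g : G,
      ∃! x, x ∈ R ∧ g ∈ DoubleCoset.doubleCoset x (H : Set G) (K : Set G) := by
  classical
  have : Finite (DoubleCoset.Quotient (H : Set G) (K : Set G)) := Quotient.finite _
  have := Fintype.ofFinite (DoubleCoset.Quotient (H : Set G) (K : Set G))
  refine ⟨Finset.univ.image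
    fun q : DoubleCoset.Quotient (H : Set G) (K : Set G) => Quotient.out q, fun g => ?_⟩
  have hmem : ∀ x, g ∈ DoubleCoset.doubleCoset x (H : Set G) (K : Set G) ↔
      DoubleCoset.mk H K x = DoubleCoset.mk H K g := fun x => by
    rw [DoubleCoset.mem_doubleCoset, DoubleCoset.eq]; rfl
  refine ⟨Quotient.out (DoubleCoset.mk H K g),
    ⟨Finset.mem_image_of_mem _ (Finset.mem_univ _), (hmem _).2 (DoubleCoset.out_eq' H K _)⟩, ?_⟩
  rintro x ⟨hx, hg⟩
  obtain ⟨q, -, rfl⟩ := Finset.mem_image.1 hx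
  rw [← (hmem _).1 hg]
  exact congrArg Quotient.out (DoubleCoset.out_eq' H K q).symm

/-- Every iso-comma span of homomorphisms is a sum of spans of groups, one for each double coset. -/
theorem exists_psh_pll_eq_sum (b : P →* G) (u : L →* G) :
    ∃ (J : Type) (_ : Fintype J) (Q : J → Type) (_ : ∀ j, Group (Q j)) (_ : ∀ j, Finite (Q j))
      (c : ∀ j, Q j →* P) (d : ∀ j, Q j →* L), psh b ≫ pll u = ∑ j, pll (c j) ≫ psh (d j) ∧
      (∀ j q, c j q = 1 → d j q = 1 → q = 1) ∧
      ∀ j, ∃ x : G, (∀ q, x * b (c j q) = u (d j q) * x) ∧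
        ∀ p l, x * b p = u l * x → ∃ q, c j q = p ∧ d j q = l := by
  obtain ⟨R, hR⟩ := exists_doubleCoset_representatives u.range b.range
  -- The twisted fibre product: pairs `(p, l)` with `x * b p * x⁻¹ = u l`, the automorphism group of
  -- `x` in the iso-comma groupoid.
  let Q : R → Subgroup (P × L) := fun x =>
    ((MulAut.conj (x : G)).toMonoidHom.comp (b.comp (MonoidHom.fst P L))).eqLocus
      (u.comp (MonoidHom.snd P L))
  have hQ : ∀ x p l, (p, l) ∈ Q x ↔ (x : G) * b p = u l * x := fun x p l => by
    rw [← mul_inv_eq_iff_eq_mul]; exact Iff.rfl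
  let c : ∀ x : R, Q x →* P := fun x => (MonoidHom.fst P L).comp (Q x).subtype
  let d : ∀ x : R, Q x →* L := fun x => (MonoidHom.snd P L).comp (Q x).subtype
  have inj : ∀ j q, c j q = 1 → d j q = 1 → q = 1 := fun j q hc hd =>
    Subtype.ext (Prod.ext hc hd)
  have comm : ∀ (j : R) q, (j : G) * b (c j q) = u (d j q) * j := fun j q => (hQ j _ _).1 q.2
  have surj : ∀ (j : R) p l, (j : G) * b p = u l * j → ∃ q, c j q = p ∧ d j q = l :=
    fun j p l h => ⟨⟨(p, l), (hQ j p l).2 h⟩, rfl, rfl⟩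
  refine ⟨R, inferInstance, fun x => Q x, inferInstance, inferInstance, c, d, ?_, inj,
    fun j => ⟨j, comm j, surj j⟩⟩
  refine psh_pll_eq_sum b u (fun x : R => (x : G)) _ c d comm inj surj ?_ ?_
  · intro g
    obtain ⟨x, ⟨hx, hg⟩, -⟩ := hR g
    obtain ⟨_, ⟨l, rfl⟩, _, ⟨p, rfl⟩, e⟩ := DoubleCoset.mem_doubleCoset.1 hg
    exact ⟨⟨x, hx⟩, p, l, e⟩
  · intro x y p l h
    obtain ⟨z, -, hz⟩ := hR x
    refine Subtype.ext ((hz x ⟨x.2, DoubleCoset.mem_doubleCoset_self _ _ _⟩).trans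
      (hz y ⟨y.2, DoubleCoset.mem_doubleCoset.2 ⟨u l, ⟨l, rfl⟩, b p, ⟨p, rfl⟩, h⟩⟩).symm)

end Existence

variable (k : Type w) [CommRing k]

section

variable {G H L : FinGp}

/-- Precomposing with a contravariant map only lengthens the left leg, so functoriality of `pull` is
enough; `eval_comp_psh` is the mirror statement. Base change is needed only for a contravariant map
after a span, in `eval_comp_pll`. -/
theorem eval_pll_comp {P : Type} [Group P] [Finite P] (a : P →* G.carrier)
    (s : (FinGp.of P).toGpd ⟶ H.toGpd) : eval k G H (pll a ≫ s) = pull k a ≫ eval k (.of P) H s := by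
  induction s using span_induction with
  | pll_psh Q u v =>
    rw [← Category.assoc, pll_comp, eval_pll_psh, eval_pll_psh, pull_comp, Category.assoc]
  | zero =>
    rw [AddMonEnriched.comp_zero, map_zero, map_zero, Limits.comp_zero]
  | add s t hs ht =>
    rw [AddMonEnriched.comp_add, map_add, map_add, Preadditive.comp_add, hs, ht]

theorem eval_comp_psh {P : Type} [Group P] [Finite P] (d : P →* H.carrier)
    (s : G.toGpd ⟶ (FinGp.of P).toGpd) : eval k G H (s ≫ psh d) = eval k G (.of P) s ≫ push k d := by
  induction s using span_induction with
  | pll_psh Q u v =>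
    rw [Category.assoc, psh_comp, eval_pll_psh, eval_pll_psh, push_comp, Category.assoc]
  | zero =>
    rw [AddMonEnriched.zero_comp, map_zero, map_zero, Limits.zero_comp]
  | add s t hs ht =>
    rw [AddMonEnriched.add_comp, map_add, map_add, Preadditive.add_comp, hs, ht]

end

section

variable {G G' L L' P P' : Type} [Group G] [Finite G] [Group G'] [Finite G']
  [Group L] [Finite L] [Group L'] [Finite L'] [Group P] [Finite P] [Group P'] [Finite P']

/-- The base change formula for a pair of homomorphisms holds in the presented category. -/
def BaseChange (b : P →* G) (u : L →* G) : Prop :=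
  eval k (.of P) (.of L) (psh b ≫ pll u) = push k b ≫ pull k u

variable {k}

theorem eval_psh (b : P →* G) : eval k (.of P) (.of G) (psh b) = push k b := by
  have := eval_pll_psh k (G := .of P) (H := .of G) (MonoidHom.id P) b
  rwa [pll_id, Category.id_comp, pull_id, Category.id_comp] at this

theorem eval_pll (b : P →* G) : eval k (.of G) (.of P) (pll b) = pull k b := by
  have := eval_pll_psh k (G := .of G) (H := .of P) b (MonoidHom.id P)
  rwa [psh_id, Category.comp_id, push_id, Category.comp_id] at this

/-- Reduces injections to subgroup inclusions and surjections to quotient maps: isomorphisms at the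
three corners can be pulled out of both sides of the formula. -/
theorem BaseChange.of_equiv {b : P →* G} {u : L →* G} (h : BaseChange k b u) (ψ : P' ≃* P)
    (χ : L' ≃* L) (φ : G ≃* G') {b' : P' →* G'} {u' : L' →* G'} (hb : ∀ p, b' p = φ (b (ψ p)))
    (hu : ∀ l, u' l = φ (u (χ l))) : BaseChange k b' u' := by
  obtain rfl : b' = φ.toMonoidHom.comp (b.comp ψ.toMonoidHom) := MonoidHom.ext hb
  obtain rfl : u' = φ.toMonoidHom.comp (u.comp χ.toMonoidHom) := MonoidHom.ext hu
  have hφ : psh φ.toMonoidHom ≫ pll φ.toMonoidHom = 𝟙 _ := by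
    rw [psh_equiv, pll_comp, ← pll_id]; congr 1; ext x; simp
  have hφ' : push k φ.toMonoidHom ≫ pull k φ.toMonoidHom = 𝟙 _ := by
    rw [push_equiv, ← pull_comp, ← pull_id]; congr 1; ext x; simp
  have e1 : psh (φ.toMonoidHom.comp (b.comp ψ.toMonoidHom)) ≫
      pll (φ.toMonoidHom.comp (u.comp χ.toMonoidHom)) =
      pll ψ.symm.toMonoidHom ≫ (psh b ≫ pll u) ≫ psh χ.symm.toMonoidHom := by
    rw [← psh_comp, ← psh_comp, ← pll_comp, ← pll_comp, psh_equiv ψ, psh_symm_equiv χ]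
    simp only [Category.assoc]
    rw [← Category.assoc (psh φ.toMonoidHom), hφ, Category.id_comp]
  have e2 : push k (φ.toMonoidHom.comp (b.comp ψ.toMonoidHom)) ≫
      pull k (φ.toMonoidHom.comp (u.comp χ.toMonoidHom)) =
      pull k ψ.symm.toMonoidHom ≫ (push k b ≫ pull k u) ≫ push k χ.symm.toMonoidHom := by
    rw [push_comp, push_comp, pull_comp, pull_comp, push_equiv k ψ, push_equiv k χ.symm]
    simp only [Category.assoc]
    rw [← Category.assoc (push k φ.toMonoidHom), hφ', Category.id_comp]
    rfl
  rw [BaseChange, e1, e2, eval_pll_comp, eval_comp_psh, h]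

/-- Pasting of squares: the iso-comma groupoid of `b ∘ a` and `u` is obtained by first decomposing
that of `b` and `u`, then forming those of `a` with each resulting `c j`. `BaseChange.comp_right`
pastes on the other side. -/
theorem BaseChange.comp_left {b : P →* G} {u : L →* G} {a : P' →* P} (h : BaseChange k b u)
    {J : Type*} [Fintype J] {Q : J → Type} [∀ j, Group (Q j)] [∀ j, Finite (Q j)]
    {c : ∀ j, Q j →* P} {d : ∀ j, Q j →* L} (e : psh b ≫ pll u = ∑ j, pll (c j) ≫ psh (d j))
    (ha : ∀ j, BaseChange k a (c j)) : BaseChange k (b.comp a) u := by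
  rw [BaseChange, ← psh_comp, push_comp, Category.assoc, Category.assoc, ← h, e,
    AddMonEnriched.comp_sum, map_sum, map_sum, Preadditive.comp_sum]
  refine Finset.sum_congr rfl fun j _ => ?_
  rw [← Category.assoc, eval_comp_psh, ha j, eval_pll_psh, Category.assoc]

theorem BaseChange.comp_right {b : P →* G} {u : L →* G} {a : L' →* L} (h : BaseChange k b u)
    {J : Type*} [Fintype J] {Q : J → Type} [∀ j, Group (Q j)] [∀ j, Finite (Q j)]
    {c : ∀ j, Q j →* P} {d : ∀ j, Q j →* L} (e : psh b ≫ pll u = ∑ j, pll (c j) ≫ psh (d j))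
    (ha : ∀ j, BaseChange k (d j) a) : BaseChange k b (u.comp a) := by
  rw [BaseChange, ← pll_comp, pull_comp, ← Category.assoc, ← Category.assoc, ← h, e,
    AddMonEnriched.sum_comp, map_sum, map_sum, Preadditive.sum_comp]
  refine Finset.sum_congr rfl fun j _ => ?_
  rw [Category.assoc, eval_pll_comp, ha j, eval_pll_psh, Category.assoc]

/-- The first of four model cases, each settled by one mixed relation: here `Rel.mackey`, and below
`Rel.defl_res`, `Rel.infl_ind` and `Rel.infl_defl`. -/
theorem baseChange_subtype_subtype (K H : Subgroup G) : BaseChange k K.subtype H.subtype := by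
  obtain ⟨R, hR⟩ := exists_doubleCoset_representatives H K
  rw [BaseChange, psh_pll_mackey H K R hR, push_subtype, pull_subtype, ← Functor.map_comp,
    (Rel.mackey H K R hR).quo_map_eq, map_sum, Functor.map_sum]
  refine Finset.sum_congr rfl fun x _ => ?_
  rw [psh_comp, eval_pll_psh, push_comp, push_iso, push_subtype, pull_subtype, ← Functor.map_comp,
    ← Functor.map_comp]

theorem push_subgroupMap (H N : Subgroup G) [N.Normal] :
    push k ((QuotientGroup.mk' N).subgroupMap H) =
      (quo k).map (defl k (N.subgroupOf H)) ≫ (quo k).map (iso k (quotIso H N)) := by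
  rw [← push_mk, ← push_iso, ← push_comp]; rfl

theorem pull_subgroupMap (H N : Subgroup G) [N.Normal] :
    pull k ((QuotientGroup.mk' N).subgroupMap H) =
      (quo k).map (iso k (quotIso H N).symm) ≫ (quo k).map (infl k (N.subgroupOf H)) := by
  rw [← pull_mk, ← pull_iso, ← pull_comp]; rfl

theorem baseChange_mk_subtype (N : Subgroup G) [N.Normal] (I : Subgroup (G ⧸ N)) :
    BaseChange k (QuotientGroup.mk' N) I.subtype := by
  obtain ⟨H, h, rfl⟩ := exists_eq_imageMod N I
  rw [BaseChange, psh_pll_image H N h, eval_pll_psh, push_subgroupMap, push_mk, pull_subtype,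
    pull_subtype, ← Functor.map_comp, ← Functor.map_comp, ← Functor.map_comp]
  exact (Rel.defl_res H N h).quo_map_eq.symm

theorem baseChange_subtype_mk (N : Subgroup G) [N.Normal] (I : Subgroup (G ⧸ N)) :
    BaseChange k I.subtype (QuotientGroup.mk' N) := by
  obtain ⟨H, h, rfl⟩ := exists_eq_imageMod N I
  rw [BaseChange, image_psh_pll H N h, eval_pll_psh, pull_subgroupMap, pull_mk, push_subtype,
    push_subtype, Category.assoc]
  refine (quoIso (quotIso H N)).inv_comp_eq.2 ?_
  rw [← Functor.map_comp, (Rel.infl_ind H N h).quo_map_eq, Functor.map_comp, Functor.map_comp]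
  rfl

theorem baseChange_mk_mk (M N : Subgroup G) [M.Normal] [N.Normal] (h : M ⊓ N = ⊥) :
    BaseChange k ((quotSupIso M N).toMonoidHom.comp
        (QuotientGroup.mk' ((M ⊔ N).map (QuotientGroup.mk' M))))
      (QuotientGroup.mk' ((M ⊔ N).map (QuotientGroup.mk' N))) := by
  rw [BaseChange, ← pll_psh_quotient M N h, eval_pll_psh, push_comp, push_iso, push_mk, pull_mk,
    push_mk, pull_mk, Category.assoc, ← Functor.map_comp, ← Functor.map_comp, ← Functor.map_comp]
  exact (Rel.infl_defl M N h).quo_map_eq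

theorem baseChange_injective_injective (b : P →* G) (u : L →* G) (hb : Function.Injective b)
    (hu : Function.Injective u) : BaseChange k b u :=
  (baseChange_subtype_subtype b.range u.range).of_equiv (MonoidHom.ofInjective hb)
    (MonoidHom.ofInjective hu) (MulEquiv.refl G) (fun _ => rfl) (fun _ => rfl)

theorem baseChange_injective_surjective (b : P →* G) (u : L →* G) (hb : Function.Injective b)
    (hu : Function.Surjective u) : BaseChange k b u := by
  let e := QuotientGroup.quotientKerEquivOfSurjective u hu
  let b' : P →* L ⧸ u.ker := e.symm.toMonoidHom.comp b
  have hb' : Function.Injective b' := e.symm.injective.comp hb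
  exact (baseChange_subtype_mk u.ker b'.range).of_equiv (MonoidHom.ofInjective hb')
    (MulEquiv.refl L) e (fun p => (e.apply_symm_apply (b p)).symm) (fun _ => rfl)

theorem baseChange_surjective_injective (b : P →* G) (u : L →* G) (hb : Function.Surjective b)
    (hu : Function.Injective u) : BaseChange k b u := by
  let e := QuotientGroup.quotientKerEquivOfSurjective b hb
  let u' : L →* P ⧸ b.ker := e.symm.toMonoidHom.comp u
  have hu' : Function.Injective u' := e.symm.injective.comp hu
  exact (baseChange_mk_subtype b.ker u'.range).of_equiv (MulEquiv.refl P)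
    (MonoidHom.ofInjective hu') e (fun _ => rfl) (fun p => (e.apply_symm_apply (u p)).symm)

/-- Let `Q` be the pullback of `b` and `u`, with projections `c` and `d`. These are onto because `u`
and `b` are, and their kernels meet trivially. Hence `P = Q / ker c`, `L = Q / ker d` and `G = Q /
(ker c · ker d)`, and the square is the one of `baseChange_mk_mk`. -/
theorem baseChange_surjective_surjective (b : P →* G) (u : L →* G) (hb : Function.Surjective b)
    (hu : Function.Surjective u) : BaseChange k b u := by
  let Q : Subgroup (P × L) := (b.comp (MonoidHom.fst P L)).eqLocus (u.comp (MonoidHom.snd P L))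
  let c : Q →* P := (MonoidHom.fst P L).comp Q.subtype
  let d : Q →* L := (MonoidHom.snd P L).comp Q.subtype
  have hQ : ∀ q : Q, b (c q) = u (d q) := fun q => q.2
  have hc : Function.Surjective c := fun p => by
    obtain ⟨l, hl⟩ := hu (b p)
    exact ⟨⟨(p, l), hl.symm⟩, rfl⟩
  have hd : Function.Surjective d := fun l => by
    obtain ⟨p, hp⟩ := hb (u l)
    exact ⟨⟨(p, l), hp⟩, rfl⟩
  have hcd : c.ker ⊓ d.ker = ⊥ := by
    rw [eq_bot_iff]
    rintro q ⟨h1, h2⟩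
    exact Subtype.ext (Prod.ext h1 h2)
  let e := QuotientGroup.quotientKerEquivOfSurjective c hc
  let f := QuotientGroup.quotientKerEquivOfSurjective d hd
  let D := (c.ker ⊔ d.ker).map (QuotientGroup.mk' d.ker)
  let u' : Q ⧸ d.ker →* G := u.comp f.toMonoidHom
  have hu' : Function.Surjective u' := hu.comp f.surjective
  have hker : D = u'.ker := by
    ext x
    obtain ⟨q, rfl⟩ := QuotientGroup.mk'_surjective d.ker x
    change _ ↔ u (d q) = 1
    constructor
    · rintro ⟨z, hz, e1⟩
      obtain ⟨y, hy, w, hw, rfl⟩ := Subgroup.mem_sup_of_normal_right.1 hz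
      have e2 : d (y * w) = d q := congrArg f e1
      rw [← e2, map_mul, show d w = 1 from hw, mul_one, ← hQ y, show c y = 1 from hy, map_one]
    · intro h
      -- If `u (d q) = 1`, then `(1, d q)` lies in `ker c` and has the same class as `q` modulo `ker
      -- d`.
      refine ⟨⟨(1, q.1.2), (map_one b).trans h.symm⟩, Subgroup.mem_sup_left rfl, ?_⟩
      exact f.injective rfl
  let φ : (Q ⧸ d.ker) ⧸ D ≃* G := (QuotientGroup.quotientMulEquivOfEq hker).trans
    (QuotientGroup.quotientKerEquivOfSurjective u' hu')
  have hφ : ∀ q : Q, φ (QuotientGroup.mk' D (QuotientGroup.mk' d.ker q)) = u (d q) := fun _ => rfl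
  refine (baseChange_mk_mk c.ker d.ker hcd).of_equiv e.symm f.symm φ (fun p => ?_) (fun l => ?_)
  · obtain ⟨q, rfl⟩ := hc p
    have he : e.symm (c q) = QuotientGroup.mk' c.ker q := e.symm_apply_eq.2 rfl
    rw [he]
    exact (hQ q).trans ((hφ q).symm.trans (congrArg φ (quotSupIso_mk c.ker d.ker q).symm))
  · obtain ⟨q, rfl⟩ := hd l
    have he : f.symm (d q) = QuotientGroup.mk' d.ker q := f.symm_apply_eq.2 rfl
    rw [he]
    exact (hφ q).symm

/-- Factor `b` through its range. In the iso-comma square of the inclusion with the injective `u`,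
each `c j` is again injective: if `c j q = 1`, then `u (d j q) = 1`, so `q = 1`. What is left is the
surjective-injective case. -/
theorem baseChange_injective (b : P →* G) (u : L →* G) (hu : Function.Injective u) :
    BaseChange k b u := by
  obtain ⟨J, _, Q, _, _, c, d, e, inj, h⟩ := exists_psh_pll_eq_sum b.range.subtype u
  refine (baseChange_injective_injective b.range.subtype u Subtype.val_injective hu).comp_left
    (a := b.rangeRestrict) e fun j => ?_
  refine baseChange_surjective_injective _ _ b.rangeRestrict_surjective
    ((injective_iff_map_eq_one _).2 fun q hq => inj j q hq (hu ?_))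
  obtain ⟨x, comm, -⟩ := h j
  have := comm q
  rw [hq, map_one, mul_one, eq_comm, mul_eq_right] at this
  rw [this, map_one]

/-- As for injective `u`, except that each `c j` now inherits surjectivity from `u`: a given `p` is
matched by any `l` with `u l = x p x⁻¹`. -/
theorem baseChange_surjective (b : P →* G) (u : L →* G) (hu : Function.Surjective u) :
    BaseChange k b u := by
  obtain ⟨J, _, Q, _, _, c, d, e, inj, h⟩ := exists_psh_pll_eq_sum b.range.subtype u
  refine (baseChange_injective_surjective b.range.subtype u Subtype.val_injective hu).comp_left
    (a := b.rangeRestrict) e fun j => ?_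
  refine baseChange_surjective_surjective _ _ b.rangeRestrict_surjective fun p => ?_
  obtain ⟨x, -, surj⟩ := h j
  obtain ⟨l, hl⟩ := hu (x * b.range.subtype p * x⁻¹)
  obtain ⟨q, hq, -⟩ := surj p l (by rw [hl, inv_mul_cancel_right])
  exact ⟨q, hq⟩

/-- Factor `u` through its range and paste: the inclusion is the injective case, and the surjective
case applies to every `d j`, since it puts no condition on the other map. -/
theorem baseChange (b : P →* G) (u : L →* G) : BaseChange k b u := by
  obtain ⟨J, _, Q, _, _, c, d, e, -, -⟩ := exists_psh_pll_eq_sum b u.range.subtype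
  exact (baseChange_injective b u.range.subtype Subtype.val_injective).comp_right
    (a := u.rangeRestrict) e fun j => baseChange_surjective _ _ u.rangeRestrict_surjective

end

section

variable {k} {G H L : FinGp}

theorem eval_comp_pll {P : Type} [Group P] [Finite P] (u : P →* H.carrier)
    (s : G.toGpd ⟶ H.toGpd) : eval k G (.of P) (s ≫ pll u) = eval k G H s ≫ pull k u := by
  induction s using span_induction with
  | pll_psh Q a b =>
    rw [Category.assoc, eval_pll_comp, baseChange, eval_pll_psh, Category.assoc]
  | zero =>
    rw [AddMonEnriched.zero_comp, map_zero, map_zero, Limits.zero_comp]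
  | add s t hs ht =>
    rw [AddMonEnriched.add_comp, map_add, map_add, Preadditive.add_comp, hs, ht]

/-- Evaluation of spans of groups in the presented category is functorial. -/
theorem eval_comp (s : G.toGpd ⟶ H.toGpd) (t : H.toGpd ⟶ L.toGpd) :
    eval k G L (s ≫ t) = eval k G H s ≫ eval k H L t := by
  induction t using span_induction with
  | pll_psh Q a b =>
    rw [← Category.assoc, eval_comp_psh, eval_comp_pll, eval_pll_psh, Category.assoc]
  | zero =>
    rw [AddMonEnriched.comp_zero, map_zero, map_zero, Limits.comp_zero]
  | add s t hs ht =>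
    rw [AddMonEnriched.comp_add, map_add, map_add, Preadditive.comp_add, hs, ht]

theorem eval_id : eval k G G (𝟙 G.toGpd) = 𝟙 _ :=
  (eval_psh (MonoidHom.id G.carrier)).trans (push_id k)

theorem eval_span (e : Elem G H) : eval k G H e.span.cls = (quo k).map (gen k e) := by
  cases e with
  | res H => exact (eval_pll H.subtype).trans (pull_subtype k H)
  | ind H => exact (eval_psh H.subtype).trans (push_subtype k H)
  | infl N => exact (eval_pll (QuotientGroup.mk' N)).trans (pull_mk k N)
  | defl N => exact (eval_psh (QuotientGroup.mk' N)).trans (push_mk k N)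
  | iso f => exact (eval_psh f.toMonoidHom).trans (push_iso k f)

end
end BaseChange

/-! ### Realization is bijective modulo the relations -/

section Faithful

variable (k : Type w) [CommRing k]

/-- A string of elementary spans as a morphism of the free linear category. -/
noncomputable def pathMap {G H : FinGp} (p : Quiver.Path G H) : freeObj k G ⟶ freeObj k H :=
  (Free.embedding k (Paths FinGp)).map p

/-- A string of elementary spans represents the class of a span, whose evaluation in the presented
category is the class of the string. -/
theorem exists_span_of_path {G H : FinGp} (p : Quiver.Path G H) :
    ∃ s : G.toGpd ⟶ H.toGpd, Realizes k (pathMap k p) s ∧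
      eval k G H s = (quo k).map (pathMap k p) := by
  induction p with
  | nil =>
    have he : pathMap k (Quiver.Path.nil : Quiver.Path G G) = 𝟙 _ :=
      (Free.embedding k (Paths FinGp)).map_id _
    refine ⟨𝟙 _, ?_, ?_⟩
    · rw [he]
      exact Realizes.id G
    · rw [he]
      exact eval_id.trans ((quo k).map_id _).symm
  | cons p e ih =>
    obtain ⟨s, hs, hs'⟩ := ih
    have he : pathMap k (Quiver.Path.cons p e) = pathMap k p ≫ gen k e :=
      (Free.embedding k (Paths FinGp)).map_comp p ((Paths.of FinGp).map e)
    refine ⟨s ≫ (Elem.span e).cls, ?_, ?_⟩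
    · rw [he]
      exact hs.comp (realizeMap_gen k e)
    · rw [he, eval_comp, hs', eval_span, Functor.map_comp]

/-- The linear extension of the evaluation of spans in the presented category. -/
noncomputable def evalLin (G H : FinGp) :
    KLin.Hom k G.toGpd H.toGpd →ₗ[k] (pObj k G.carrier ⟶ pObj k H.carrier) :=
  LinearMap.liftBaseChange k
    (Algebra.GrothendieckAddGroup.lift (eval k G H)).toIntLinearMap

theorem evalLin_ι {G H : FinGp} (s : G.toGpd ⟶ H.toGpd) :
    evalLin k G H (KLin.ι k s) = eval k G H s := by
  rw [evalLin, KLin.ι, LinearMap.liftBaseChange_tmul, one_smul]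
  exact KLin.gr_lift_of _ _

instance quo_linear : (quo k).Linear k where
  map_smul _ _ := rfl

/-- Both sides are linear in `a`, so it is enough to compare them on strings, where functoriality of
`eval` applies. This left inverse gives injectivity without choosing a basis of the modules of
spans. -/
theorem evalLin_realizeMap {G H : FinGp} (a : freeObj k G ⟶ freeObj k H) :
    evalLin k G H (realizeMap k a) = (quo k).map a := by
  have key : (evalLin k G H).comp (freeLiftMap k (realizePath k) _ _) =
      (quo k).mapLinearMap k (X := freeObj k G) (Y := freeObj k H) := by
    refine Finsupp.lhom_ext' fun p => LinearMap.ext_ring ?_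
    obtain ⟨s, hs, hs'⟩ := exists_span_of_path k p
    exact (congrArg (evalLin k G H) hs).trans ((evalLin_ι k s).trans hs')
  exact DFunLike.congr_fun key a

/-- Two formal combinations of strings of elementary spans represent the same map if and only if
they are congruent modulo the relations. -/
theorem realizeMap_eq_iff {G H : FinGp} (a b : freeObj k G ⟶ freeObj k H) :
    realizeMap k a = realizeMap k b ↔ a - b ∈ relIdeal k _ _ := by
  constructor
  · intro h
    rw [← quo_map_eq_iff, ← evalLin_realizeMap, ← evalLin_realizeMap, h]
  · exact realize_eq_of_relCongr k (relationsHold k) _ _ a b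

/-- The class of every homomorphism is represented by a string of elementary spans. -/
theorem exists_realizes_psh {G H : Type} [Group G] [Finite G] [Group H] [Finite H] (u : G →* H) :
    ∃ a : gp k G ⟶ gp k H, Realizes k a (psh u) := by
  refine ⟨_, ((realizes_defl u.ker).comp ((realizes_iso
    (QuotientGroup.quotientKerEquivRange u)).comp (realizes_ind u.range))).congr ?_⟩
  rw [psh_comp, psh_comp]; rfl

theorem exists_realizes_pll {G H : Type} [Group G] [Finite G] [Group H] [Finite H] (u : G →* H) :
    ∃ a : gp k H ⟶ gp k G, Realizes k a (pll u) := by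
  refine ⟨_, ((realizes_res u.range).comp ((realizes_iso'
    (QuotientGroup.quotientKerEquivRange u).symm).comp (realizes_infl u.ker))).congr ?_⟩
  rw [pll_comp, pll_comp]; rfl

theorem exists_realizes {G H : FinGp} (s : G.toGpd ⟶ H.toGpd) :
    ∃ a : freeObj k G ⟶ freeObj k H, Realizes k a s := by
  induction s using span_induction with
  | pll_psh P u v =>
    obtain ⟨a, ha⟩ := exists_realizes_pll k u
    obtain ⟨b, hb⟩ := exists_realizes_psh k v
    exact ⟨a ≫ b, ha.comp hb⟩
  | zero => exact ⟨0, ((realize k).map_zero _ _).trans (map_zero (ιHom k _ _)).symm⟩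
  | add s t hs ht =>
    obtain ⟨a, ha⟩ := hs
    obtain ⟨b, hb⟩ := ht
    exact ⟨a + b, (realize k).map_add.trans ((congrArg₂ (· + ·) ha hb).trans
      (map_add (ιHom k _ _) s t).symm)⟩

/-- Evaluation of formal combinations, as a linear map. -/
noncomputable def realizeLin (G H : FinGp) :
    (freeObj k G ⟶ freeObj k H) →ₗ[k] KLin.Hom k G.toGpd H.toGpd :=
  (realize k).mapLinearMap k (X := freeObj k G) (Y := freeObj k H)

/-- Every map between finite groups is a linear combination of composites of elementary spans. -/
theorem realizeMap_surjective {G H : FinGp} (f : grp k G ⟶ grp k H) :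
    ∃ a : freeObj k G ⟶ freeObj k H, realizeMap k a = f := by
  -- The range is everything once the projection to its cokernel vanishes, and a linear map on the
  -- linearization is determined by its values on classes of spans.
  have key : (LinearMap.range (realizeLin k G H)).mkQ = 0 := KLin.hom_ext k fun s => by
    obtain ⟨a, ha⟩ := exists_realizes k s
    exact (Submodule.Quotient.mk_eq_zero _).2 ⟨a, ha⟩
  exact (Submodule.Quotient.mk_eq_zero (LinearMap.range (realizeLin k G H))).1
    (DFunLike.congr_fun key f)

end Faithful

/-! ### Biproducts, decomposition of objects and the additive hull -/

section Additive

variable (k : Type w) [CommRing k]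

theorem sum_inl_inr_total (A B : FinGpd) :
    pullF (CategoryTheory.Sum.inl_ A B) ≫ pushF (Y := A.coprod B) (CategoryTheory.Sum.inl_ A B) +
      pullF (CategoryTheory.Sum.inr_ A B) ≫ pushF (Y := A.coprod B) (CategoryTheory.Sum.inr_ A B) =
    𝟙 (A.coprod B) := by
  rw [pullF_pushF, pullF_pushF]
  exact (PreSpan.cls_eq_add (PreSpan.id (A.coprod B)) (CategoryTheory.Sum.inl_ A B)
    (CategoryTheory.Sum.inr_ A B) (fun _ _ f => f.elim) (fun s => by
      rcases s with a | b
      · exact .inl ⟨a, ⟨𝟙 _⟩⟩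
      · exact .inr ⟨b, ⟨𝟙 _⟩⟩)).symm

theorem inl_comp_inr (A B : FinGpd) : pushF (Y := A.coprod B) (CategoryTheory.Sum.inl_ A B) ≫
    pullF (CategoryTheory.Sum.inr_ A B) = 0 :=
  pushF_pullF_of_disjoint (Z := A.coprod B) _ _ fun _ _ f => PEmpty.elim f

theorem inr_comp_inl (A B : FinGpd) : pushF (Y := A.coprod B) (CategoryTheory.Sum.inr_ A B) ≫
    pullF (CategoryTheory.Sum.inl_ A B) = 0 :=
  pushF_pullF_of_disjoint (Z := A.coprod B) _ _ fun _ _ f => PEmpty.elim f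

/-- The disjoint union of two groupoids is their biproduct in the category of spans. -/
noncomputable def coprodBicone (X Y : SpanCat k) : Limits.BinaryBicone X Y where
  pt := ⟨X.as.coprod Y.as⟩
  fst := ιHom k _ _ (pullF (CategoryTheory.Sum.inl_ X.as Y.as))
  snd := ιHom k _ _ (pullF (CategoryTheory.Sum.inr_ X.as Y.as))
  inl := ιHom k _ _ (pushF (CategoryTheory.Sum.inl_ X.as Y.as))
  inr := ιHom k _ _ (pushF (CategoryTheory.Sum.inr_ X.as Y.as))
  inl_fst := by rw [ιHom_comp, pushF_pullF_self]; rfl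
  inl_snd := by rw [ιHom_comp, inl_comp_inr, map_zero]
  inr_fst := by rw [ιHom_comp, inr_comp_inl, map_zero]
  inr_snd := by rw [ιHom_comp, pushF_pullF_self]; rfl

instance : Limits.HasBinaryBiproducts (SpanCat k) where
  has_binary_biproduct X Y := ⟨⟨⟨coprodBicone k X Y, Limits.isBinaryBilimitOfTotal _ (by
    exact (congrArg₂ (· + ·) (ιHom_comp k _ _) (ιHom_comp k _ _)).trans
      ((map_add (ιHom k _ _) _ _).symm.trans (congrArg _ (sum_inl_inr_total X.as Y.as))))⟩⟩⟩

instance : Limits.HasZeroObject (SpanCat k) :=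
  ⟨⟨FinGpd.empty⟩, (Limits.IsZero.iff_id_eq_zero _).2 (by
    have : 𝟙 FinGpd.empty = 0 := PreSpan.cls_eq_iff.2
      (PreSpan.equiv_of_isEmpty _ _ (fun x => x.as.elim) (fun x => x.as.elim))
    rw [← ιHom_id, this, map_zero])⟩

instance spanCat_hasFiniteBiproducts : Limits.HasFiniteBiproducts (SpanCat k) :=
  have := hasFiniteProducts_of_has_binary_and_terminal (C := SpanCat k)
  Limits.HasFiniteBiproducts.of_hasFiniteProducts

/-- A finite groupoid is the direct sum of the automorphism groups of representatives of its
components. -/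
noncomputable def componentBicone (A : FinGpd) {J : Type} (e : J ≃ A.Component) :
    Limits.Bicone fun j => grp k (.of (End (A.rep (e j)))) where
  pt := ⟨A⟩
  π j := ιHom k _ _ (pullF (A.endFunctor (A.rep (e j))))
  ι j := ιHom k _ _ (pushF (A.endFunctor (A.rep (e j))))
  ι_π i j := by
    rw [ιHom_comp]
    split_ifs with h
    · subst h
      rw [pushF_pullF_self]; rfl
    · rw [pushF_pullF_of_disjoint _ _
        fun _ _ f => h (e.injective (A.eq_of_rep_hom (e i) (e j) f)), map_zero]

/-- The inclusions of the automorphism groups are fully faithful with disjoint images, and the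
identity span of a groupoid is the sum over its components; these are the biproduct identities. -/
theorem exists_iso_biproduct (X : SpanCat k) : ∃ (n : ℕ) (G : Fin n → FinGp),
    Nonempty (X ≅ Limits.biproduct fun i => grp k (G i)) := by
  let e := (Fintype.equivFin X.as.Component).symm
  refine ⟨_, fun i => .of (End (X.as.rep (e i))), ⟨Limits.biproduct.uniqueUpToIso _
    (Limits.isBilimitOfTotal (componentBicone k X.as e) ?_)⟩⟩
  change ∑ j, ιHom k _ _ _ ≫ ιHom k _ _ _ = ιHom k _ _ (𝟙 X.as)
  simp only [ιHom_comp]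
  rw [← map_sum]
  congr 1
  refine (e.sum_comp fun c => pullF (X.as.endFunctor (X.as.rep c)) ≫
    pushF (X.as.endFunctor (X.as.rep c))).trans ?_
  simp only [pullF_pushF]
  exact (PreSpan.cls_eq_sum_components (PreSpan.id X.as)).symm

instance comparison_full : (comparison k (relationsHold k)).Full where
  map_surjective {X Y} f := by
    obtain ⟨a, ha⟩ := realizeMap_surjective k (G := X.as) (H := Y.as) f
    exact ⟨(quo k).map a, ha⟩

instance comparison_faithful : (comparison k (relationsHold k)).Faithful where
  map_injective {X Y} f g h := by
    obtain ⟨a, rfl⟩ := (quo k).map_surjective f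
    obtain ⟨b, rfl⟩ := (quo k).map_surjective g
    exact (quo_map_eq_iff k a b).2 ((realizeMap_eq_iff k (G := X.as) (H := Y.as) a b).1 h)

/-- The additive extension of a fully faithful functor which reaches every object up to finite
direct sums is an equivalence. -/
theorem matLift_isEquivalence {C D : Type u} [Category.{v} C] [Preadditive C]
    [Category.{v} D] [Preadditive D] [Limits.HasFiniteBiproducts D] (F : C ⥤ D) [F.Additive] [F.Full] [F.Faithful]
    (h : ∀ X : D, ∃ (n : ℕ) (G : Fin n → C),
      Nonempty (X ≅ Limits.biproduct fun i => F.obj (G i))) :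
    (Mat_.lift F).IsEquivalence where
  faithful := ⟨fun {M N} f g e => by
    funext i j
    apply F.map_injective
    have := congrArg (fun u => Limits.biproduct.components u i j) e
    simpa using this⟩
  full := ⟨fun {M N} f => ⟨fun i j => F.preimage (Limits.biproduct.components f i j), by
    change Limits.biproduct.matrix (fun i j => F.map (F.preimage _)) = f
    simp only [F.map_preimage]
    exact Limits.biproduct.components_matrix f⟩⟩
  essSurj := ⟨fun X => by
    obtain ⟨n, G, ⟨e⟩⟩ := h X
    exact ⟨⟨Fin n, G⟩, ⟨e.symm⟩⟩⟩

end Additive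

end SpanPres

/-! ### The presentation theorem -/

theorem mainTheorem4 (k : Type*) [CommRing k] :
    -- the category of spans is additive, and all the relations hold in it
    ∃ (_ : Limits.HasFiniteBiproducts (SpanPres.SpanCat k)) (h : SpanPres.RelationsHold k),
      -- every object is a direct sum of finite groups
      (∀ X : SpanPres.SpanCat k, ∃ (n : ℕ) (G : Fin n → SpanPres.FinGp),
        Nonempty (X ≅ Limits.biproduct fun i => SpanPres.grp k (G i))) ∧
      -- every morphism is a matrix of `k`-linear combinations of composites of elementary spans
      (∀ (m n : ℕ) (G : Fin m → SpanPres.FinGp) (H : Fin n → SpanPres.FinGp)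
        (f : (Limits.biproduct fun i => SpanPres.grp k (G i)) ⟶
          Limits.biproduct fun j => SpanPres.grp k (H j)),
        ∃ a : ∀ i j, SpanPres.freeObj k (G i) ⟶ SpanPres.freeObj k (H j),
          f = Limits.biproduct.matrix fun i j => SpanPres.realizeMap k (a i j)) ∧
      -- two such matrices are equal iff they are congruent modulo the ideal of the relations
      (∀ (m n : ℕ) (G : Fin m → SpanPres.FinGp) (H : Fin n → SpanPres.FinGp)
        (a b : ∀ i j, SpanPres.freeObj k (G i) ⟶ SpanPres.freeObj k (H j)),
        (Limits.biproduct.matrix fun i j => SpanPres.realizeMap k (a i j)) =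
            (Limits.biproduct.matrix fun i j => SpanPres.realizeMap k (b i j)) ↔
          ∀ i j, a i j - b i j ∈ SpanPres.relIdeal k _ _) ∧
      -- the additive hull of the presented `k`-linear category is the category of spans
      (Mat_.lift (SpanPres.comparison k h)).IsEquivalence := by
  refine ⟨SpanPres.spanCat_hasFiniteBiproducts k, SpanPres.relationsHold k,
    SpanPres.exists_iso_biproduct k, fun m n G H f => ?_, fun m n G H a b => ?_, ?_⟩
  · choose a ha using fun i j =>
      SpanPres.realizeMap_surjective k (Limits.biproduct.components f i j)
    refine ⟨a, ?_⟩
    simp only [ha]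
    exact (Limits.biproduct.components_matrix f).symm
  · simp only [← SpanPres.realizeMap_eq_iff]
    constructor
    · intro h i j
      have := congrArg (fun u => Limits.biproduct.components u i j) h
      simpa only [Limits.biproduct.matrix_components] using this
    · intro h
      congr 1
      funext i j
      exact h i j
  · refine SpanPres.matLift_isEquivalence _ fun X => ?_
    obtain ⟨n, G, e⟩ := SpanPres.exists_iso_biproduct k X
    -- The comparison functor sends the class of `freeObj k (G i)` to `grp k (G i)` by definition,
    -- so the same isomorphism serves.
    exact ⟨n, fun i => ⟨SpanPres.freeObj k (G i)⟩, e⟩
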